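/- **Setting.** Let $\beta>0$ and let $\mathcal L^-=\mathbb Z^2\cap\{x_2\le 0\}$ be the substrate. For $0<\varepsilon<\pi/6$ consider a two-body potential $v_2:[0,\infty)\to\mathbb R\cup\{+\infty\}$ such that - $v_2(1)=-1$ and $v_2(r)>-1$ for all $r\neq 1$; - there is $1<r_0<\sqrt2$ with $v_2(r)=0$ for all $r\ge r_0$ (such an $r_0$ is fixed); - $v_2(r)>\varepsilon^{-1}$ for all $r\in[0,1-\varepsilon]$; and a three-body potential $v_3:[0,2\pi]\to\mathbb R$ such that - $v_3(\theta)=v_3(2\pi-\theta)$ for all $\theta\in[0,2\pi]$; - $v_3(k\pi/2)=0$ for $k=1,2,3$ and $v_3(\theta)>0$ for $\theta\notin\{\pi/2,\pi,3\pi/2\}$; - $v_3(\theta)\ge 4(\pi/10-\varepsilon)^{-1}|\theta-\pi|$ for $\theta\in[\pi-\varepsilon,\pi+\varepsilon]$, with equality only if $\theta=\pi$; - $v_3(\theta)>\max\{1,2\beta\}\,\frac{4}{(1-\varepsilon)^2}\big(\sqrt2+\tfrac12\big)^2$ for every $\theta\in[0,2\pi]$ that lies in none of the intervals $[k\pi/2-\varepsilon,k\pi/2+\varepsilon]$,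 $k=1,2,3$. The energy of an $N$-point set $C_N\subset\mathbb R^2\cap\{x_2>0\}$ is $$\mathcal F_\beta(C_N)=\frac12\sum_{\substack{x,y\in C_N\\ x\ne y}}v_2(|x-y|)+\beta\sum_{x\in C_N,\ z\in\mathcal L^-}v_2(|x-z|)+\frac12\sum_{x,y,z}v_3(\theta_{x,y,z}),$$ where the last sum runs over all triples of pairwise distinct points $x,y,z\in C_N\cup\mathcal L^-$ with $|x-y|<r_0$ and $|y-z|<r_0$, and $\theta_{x,y,z}\in[0,2\pi)$ is the angle at $y$ from $x-y$ to $z-y$, counted clockwise. For $N\ge1$ put $$m_\beta(N)=\min_{h\in\{1,\dots,N\}}\Big(2h+2(1-\beta)\Big\lceil\frac Nh\Big\rceil\Big),\qquad h_*(\beta,N)=\max\Big\{h\in\{1,\dots,N\}:2h+2(1-\beta)\Big\lceil\frac Nh\Big\rceil=m_\beta(N)\Big\}.$$ **Theorem 2.1 (Crystallization).** For every $\beta>0$ there are $\varepsilon_0\in(0,\pi/6)$ and $N_\beta\in\mathbb N$ such that for all $0<\varepsilon<\varepsilon_0$, all $v_2$ (with range $r_0$) and $v_3$ satisfying the above conditions,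 all $N\ge N_\beta$ and all $N$-point sets $C_N\subset\mathbb R^2\cap\{x_2>0\}$, $$\mathcal F_\beta(C_N)\ \ge\ -2N+\tfrac12\,m_\beta(N).$$ If equality holds, then $C_N\subset\mathbb Z^2\cap\{x_2>0\}$ and $\#\big(C_N\cap\{x_2=1\}\big)\ge N/h_*(\beta,N)$. -/

import Mathlib

/-!
The plane `ℝ²` is modelled by `ℂ`: the point `(x₁, x₂)` is `x₁ + i x₂`, so `x₁ = x.re`, `x₂ = x.im`,
and `‖x - y‖` is the Euclidean distance.
-/

namespace SubstrateCrystal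

noncomputable section

/-- The square lattice `ℤ²`. -/
def squareLattice : Set ℂ := {z | ∃ a b : ℤ, z = ⟨(a : ℝ), (b : ℝ)⟩}

/-- The substrate `ℤ² ∩ {x₂ ≤ 0}`. -/
def substrate : Set ℂ := squareLattice ∩ {z | z.im ≤ 0}

/-- The angle `θ_{x,y,z}` at `y` formed by the vectors `x - y` and `z - y`: the amount in `[0, 2π)`
by which `x - y` has to be turned clockwise in order to point in the direction of `z - y`
(for `x ≠ y` and `z ≠ y`). -/
def bondAngle (x y z : ℂ) : ℝ :=
  toIcoMod Real.two_pi_pos 0 (Complex.arg ((x - y) / (z - y)))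

/-- The triples `(x, y, z)` of pairwise distinct points of the configuration and the substrate with
`|x - y| < r₀` and `|y - z| < r₀`. -/
def bondTriples (r₀ : ℝ) (C : Finset ℂ) : Set (ℂ × ℂ × ℂ) :=
  {t | t.1 ∈ (C : Set ℂ) ∪ substrate ∧ t.2.1 ∈ (C : Set ℂ) ∪ substrate ∧
    t.2.2 ∈ (C : Set ℂ) ∪ substrate ∧
    t.1 ≠ t.2.1 ∧ t.2.1 ≠ t.2.2 ∧ t.1 ≠ t.2.2 ∧
    ‖t.1 - t.2.1‖ < r₀ ∧ ‖t.2.1 - t.2.2‖ < r₀}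

/-- The assumptions on the two-body potential `v₂ : [0, ∞) → ℝ ∪ {+∞}` with interaction range `r₀`
(only the values on `[0, ∞)` matter; the value `-∞` is excluded by the first two fields). -/
structure IsTwoBodyPotential (ε r₀ : ℝ) (v₂ : ℝ → EReal) : Prop where
  at_one : v₂ 1 = -1
  gt_of_ne_one : ∀ r : ℝ, 0 ≤ r → r ≠ 1 → -1 < v₂ r
  one_lt_range : 1 < r₀
  range_lt : r₀ < √2
  eq_zero : ∀ r : ℝ, r₀ ≤ r → v₂ r = 0
  repulsive : ∀ r : ℝ, 0 ≤ r → r ≤ 1 - ε → ((ε⁻¹ : ℝ) : EReal) < v₂ r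

/-- The assumptions on the three-body potential `v₃ : [0, 2π] → ℝ`
(only the values on `[0, 2π]` matter). -/
structure IsThreeBodyPotential (β ε : ℝ) (v₃ : ℝ → ℝ) : Prop where
  symm : ∀ θ ∈ Set.Icc 0 (2 * Real.pi), v₃ θ = v₃ (2 * Real.pi - θ)
  zero_half_pi : v₃ (Real.pi / 2) = 0
  zero_pi : v₃ Real.pi = 0
  zero_three_half_pi : v₃ (3 * Real.pi / 2) = 0
  pos : ∀ θ ∈ Set.Icc 0 (2 * Real.pi),
    θ ≠ Real.pi / 2 → θ ≠ Real.pi → θ ≠ 3 * Real.pi / 2 → 0 < v₃ θ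
  slope : ∀ θ ∈ Set.Icc (Real.pi - ε) (Real.pi + ε),
    4 * (Real.pi / 10 - ε)⁻¹ * |θ - Real.pi| ≤ v₃ θ
  slope_eq : ∀ θ ∈ Set.Icc (Real.pi - ε) (Real.pi + ε),
    v₃ θ = 4 * (Real.pi / 10 - ε)⁻¹ * |θ - Real.pi| → θ = Real.pi
  large : ∀ θ ∈ Set.Icc 0 (2 * Real.pi),
    θ ∉ Set.Icc (Real.pi / 2 - ε) (Real.pi / 2 + ε) ∪ Set.Icc (Real.pi - ε) (Real.pi + ε) ∪
      Set.Icc (3 * Real.pi / 2 - ε) (3 * Real.pi / 2 + ε) →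
    max 1 (2 * β) * (4 / (1 - ε) ^ 2) * (√2 + 1 / 2) ^ 2 < v₃ θ

/-- The energy of a finite configuration `C`. Under the assumptions on the potentials only finitely
many terms of the sums over the substrate and over the triples are nonzero, see
`finite_substrate_support` and `finite_triple_support`. -/
def energy (β r₀ : ℝ) (v₂ : ℝ → EReal) (v₃ : ℝ → ℝ) (C : Finset ℂ) : EReal :=
  ((1 / 2 : ℝ) : EReal) * ∑ p ∈ C.offDiag, v₂ ‖p.1 - p.2‖
  + (β : EReal) * ∑ x ∈ C, ∑ᶠ z ∈ substrate, v₂ ‖x - z‖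
  + ((1 / 2 * ∑ᶠ t ∈ bondTriples r₀ C, v₃ (bondAngle t.1 t.2.1 t.2.2) : ℝ) : EReal)

/-- `2h + 2(1-β)⌈N/h⌉`. -/
def heightEnergy (β : ℝ) (N h : ℕ) : ℝ :=
  2 * (h : ℝ) + 2 * (1 - β) * ((⌈(N : ℝ) / (h : ℝ)⌉ : ℤ) : ℝ)

/-- `m_β(N)`, the minimum of `2h + 2(1-β)⌈N/h⌉` over `h ∈ {1, …, N}` (for `N ≥ 1`). -/
def normalizedMinEnergy (β : ℝ) (N : ℕ) : ℝ :=
  sInf (heightEnergy β N '' Set.Icc 1 N)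

/-- `h_*(β, N)`, the largest `h ∈ {1, …, N}` that attains `m_β(N)` (for `N ≥ 1`). -/
def optimalHeight (β : ℝ) (N : ℕ) : ℕ :=
  sSup {h : ℕ | h ∈ Set.Icc 1 N ∧ heightEnergy β N h = normalizedMinEnergy β N}

theorem isLeast_normalizedMinEnergy (β : ℝ) {N : ℕ} (hN : 1 ≤ N) :
    IsLeast (heightEnergy β N '' Set.Icc 1 N) (normalizedMinEnergy β N) := by
  have hf : (heightEnergy β N '' Set.Icc 1 N).Finite := (Set.finite_Icc 1 N).image _
  have hne : (heightEnergy β N '' Set.Icc 1 N).Nonempty := (Set.nonempty_Icc.2 hN).image _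
  exact ⟨hne.csInf_mem hf, fun y hy => csInf_le hf.bddBelow hy⟩

theorem isGreatest_optimalHeight (β : ℝ) {N : ℕ} (hN : 1 ≤ N) :
    IsGreatest {h : ℕ | h ∈ Set.Icc 1 N ∧ heightEnergy β N h = normalizedMinEnergy β N}
      (optimalHeight β N) := by
  have hf : {h : ℕ | h ∈ Set.Icc 1 N ∧ heightEnergy β N h = normalizedMinEnergy β N}.Finite :=
    (Set.finite_Icc 1 N).subset fun h hh => hh.1
  obtain ⟨h, hh, he⟩ := (isLeast_normalizedMinEnergy β hN).1
  have hne : {h : ℕ | h ∈ Set.Icc 1 N ∧ heightEnergy β N h = normalizedMinEnergy β N}.Nonempty :=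
    ⟨h, hh, he⟩
  exact ⟨hne.csSup_mem hf, fun y hy => le_csSup hf.bddAbove hy⟩

theorem finite_squareLattice_near (x : ℂ) (R : ℝ) :
    {z : ℂ | z ∈ squareLattice ∧ ‖x - z‖ < R}.Finite := by
  have hA : (Set.Icc ⌊x.re - R⌋ ⌈x.re + R⌉ ×ˢ Set.Icc ⌊x.im - R⌋ ⌈x.im + R⌉ : Set (ℤ × ℤ)).Finite :=
    (Set.finite_Icc _ _).prod (Set.finite_Icc _ _)
  refine (hA.image fun p : ℤ × ℤ => (⟨(p.1 : ℝ), (p.2 : ℝ)⟩ : ℂ)).subset ?_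
  rintro z ⟨⟨a, b, rfl⟩, hz⟩
  have h1 := abs_lt.1 ((Complex.abs_re_le_norm _).trans_lt hz)
  have h2 := abs_lt.1 ((Complex.abs_im_le_norm _).trans_lt hz)
  simp only [Complex.sub_re, Complex.sub_im] at h1 h2
  refine ⟨(a, b), ⟨⟨?_, ?_⟩, ⟨?_, ?_⟩⟩, rfl⟩
  · exact_mod_cast (Int.floor_le _).trans (by linarith [h1.2] : x.re - R ≤ (a : ℝ))
  · exact_mod_cast (by linarith [h1.1] : (a : ℝ) ≤ x.re + R).trans (Int.le_ceil _)
  · exact_mod_cast (Int.floor_le _).trans (by linarith [h2.2] : x.im - R ≤ (b : ℝ))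
  · exact_mod_cast (by linarith [h2.1] : (b : ℝ) ≤ x.im + R).trans (Int.le_ceil _)

theorem finite_substrate_support {ε r₀ : ℝ} {v₂ : ℝ → EReal} (h : IsTwoBodyPotential ε r₀ v₂)
    (x : ℂ) : {z : ℂ | z ∈ substrate ∧ v₂ ‖x - z‖ ≠ 0}.Finite := by
  refine (finite_squareLattice_near x r₀).subset ?_
  rintro z ⟨hz, hv⟩
  exact ⟨hz.1, not_le.1 fun hle => hv (h.eq_zero _ hle)⟩

/-- Lattice vectors of length less than `√2` are the four unit vectors. -/
theorem lattice_unit {x y : ℂ} (hx : x ∈ squareLattice) (hy : y ∈ squareLattice) (hne : x ≠ y)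
    (hd : ‖x - y‖ < √2) :
    x - y = 1 ∨ x - y = -1 ∨ x - y = Complex.I ∨ x - y = -Complex.I := by
  obtain ⟨a, b, rfl⟩ := hx
  obtain ⟨c, d, rfl⟩ := hy
  have h2 : ((a - c : ℤ) : ℝ) ^ 2 + ((b - d : ℤ) : ℝ) ^ 2 < 2 := by
    have h3 : ‖(⟨(a : ℝ), (b : ℝ)⟩ - ⟨(c : ℝ), (d : ℝ)⟩ : ℂ)‖ ^ 2 < 2 := by
      have := pow_lt_pow_left₀ hd (norm_nonneg _) two_ne_zero
      simpa using this
    rw [Complex.sq_norm, Complex.normSq_apply] at h3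
    simp only [Complex.sub_re, Complex.sub_im] at h3
    push_cast
    nlinarith
  have h4 : (a - c) ^ 2 + (b - d) ^ 2 < 2 := by exact_mod_cast h2
  have h5 : -1 ≤ a - c ∧ a - c ≤ 1 := ⟨by nlinarith, by nlinarith⟩
  have h6 : -1 ≤ b - d ∧ b - d ≤ 1 := ⟨by nlinarith, by nlinarith⟩
  obtain ⟨p, hp⟩ : ∃ p, p = a - c := ⟨_, rfl⟩
  obtain ⟨q, hq⟩ : ∃ q, q = b - d := ⟨_, rfl⟩
  rw [← hp] at h4 h5
  rw [← hq] at h4 h6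
  have ha : (a : ℝ) = c + p := by rw [hp]; push_cast; ring
  have hb : (b : ℝ) = d + q := by rw [hq]; push_cast; ring
  obtain ⟨h5a, h5b⟩ := h5
  obtain ⟨h6a, h6b⟩ := h6
  have hnz : ¬ (p = 0 ∧ q = 0) := by
    rintro ⟨rfl, rfl⟩
    exact hne (by rw [ha, hb]; simp)
  have hsub : (⟨(a : ℝ), (b : ℝ)⟩ - ⟨(c : ℝ), (d : ℝ)⟩ : ℂ) = ⟨(p : ℝ), (q : ℝ)⟩ := by
    rw [ha, hb]
    apply Complex.ext <;> simp
  rw [hsub]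
  clear hsub ha hb hp hq hne hd h2
  interval_cases p <;> interval_cases q <;> simp [Complex.ext_iff] at h4 hnz ⊢

/-- Triples inside the substrate do not contribute to the energy. -/
theorem bondAngle_lattice {x y z : ℂ} (hx : x ∈ squareLattice) (hy : y ∈ squareLattice)
    (hz : z ∈ squareLattice) (hxy : x ≠ y) (hyz : y ≠ z) (hxz : x ≠ z)
    (h1 : ‖x - y‖ < √2) (h2 : ‖y - z‖ < √2) :
    bondAngle x y z = Real.pi / 2 ∨ bondAngle x y z = Real.pi ∨
      bondAngle x y z = 3 * Real.pi / 2 := by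
  have hp := Real.pi_pos
  have e1 : toIcoMod Real.two_pi_pos 0 (Real.pi / 2) = Real.pi / 2 :=
    (toIcoMod_eq_self _).2 ⟨by positivity, by linarith⟩
  have e2 : toIcoMod Real.two_pi_pos 0 Real.pi = Real.pi :=
    (toIcoMod_eq_self _).2 ⟨by positivity, by linarith⟩
  have e3 : toIcoMod Real.two_pi_pos 0 (-(Real.pi / 2)) = 3 * Real.pi / 2 := by
    rw [← toIcoMod_add_right, (toIcoMod_eq_self _).2 ⟨by linarith, by linarith⟩]
    ring
  have hzy : z - y ≠ x - y := fun h => hxz (sub_left_injective h).symm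
  rw [norm_sub_rev] at h2
  unfold bondAngle
  rcases lattice_unit hx hy hxy h1 with h | h | h | h <;>
  rcases lattice_unit hz hy hyz.symm h2 with h' | h' | h' | h' <;>
  rw [h, h'] at hzy ⊢ <;>
  first
  | exact absurd rfl hzy
  | simp [neg_div, div_neg, Complex.arg_I, Complex.arg_neg_I, Complex.arg_neg_one, e1, e2, e3]

theorem finite_triple_support {β ε r₀ : ℝ} {v₂ : ℝ → EReal} {v₃ : ℝ → ℝ}
    (h₂ : IsTwoBodyPotential ε r₀ v₂) (h₃ : IsThreeBodyPotential β ε v₃) (C : Finset ℂ) :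
    {t : ℂ × ℂ × ℂ | t ∈ bondTriples r₀ C ∧ v₃ (bondAngle t.1 t.2.1 t.2.2) ≠ 0}.Finite := by
  -- all points of a contributing triple are within distance `2 r₀` of the configuration
  let S : Set ℂ := (C : Set ℂ) ∪ ⋃ c ∈ C, {z : ℂ | z ∈ squareLattice ∧ ‖c - z‖ < 2 * r₀}
  have hS : S.Finite :=
    C.finite_toSet.union (C.finite_toSet.biUnion fun c _ => finite_squareLattice_near c _)
  refine (hS.prod (hS.prod hS)).subset ?_
  rintro ⟨x, y, z⟩ ⟨⟨hx, hy, hz, hxy, hyz, hxz, h1, h2⟩, hv⟩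
  simp only at hx hy hz hxy hyz hxz h1 h2 hv
  have hr := h₂.one_lt_range
  have key : ∃ c ∈ C, ‖c - x‖ < 2 * r₀ ∧ ‖c - y‖ < 2 * r₀ ∧ ‖c - z‖ < 2 * r₀ := by
    have h13 : ‖x - z‖ ≤ ‖x - y‖ + ‖y - z‖ := norm_sub_le_norm_sub_add_norm_sub _ _ _
    rcases hx with hx | hx
    · exact ⟨x, hx, by simp; linarith, by linarith, by linarith⟩
    rcases hy with hy | hy
    · exact ⟨y, hy, by rw [norm_sub_rev]; linarith, by simp; linarith, by linarith⟩
    rcases hz with hz | hz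
    · exact ⟨z, hz, by rw [norm_sub_rev]; linarith, by rw [norm_sub_rev]; linarith,
        by simp; linarith⟩
    exfalso
    have hlt := h₂.range_lt
    rcases bondAngle_lattice hx.1 hy.1 hz.1 hxy hyz hxz (h1.trans hlt) (h2.trans hlt) with h | h | h
    · exact hv (by rw [h, h₃.zero_half_pi])
    · exact hv (by rw [h, h₃.zero_pi])
    · exact hv (by rw [h, h₃.zero_three_half_pi])
  obtain ⟨c, hc, k1, k2, k3⟩ := key
  have mem : ∀ w : ℂ, w ∈ (C : Set ℂ) ∪ substrate → ‖c - w‖ < 2 * r₀ → w ∈ S := by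
    rintro w (hw | hw) hk
    · exact Or.inl hw
    · exact Or.inr (Set.mem_biUnion hc ⟨hw.1, hk⟩)
  exact ⟨mem x hx k1, mem y hy k2, mem z hz k3⟩

end

end SubstrateCrystal

/-!
The lower bound is proved by stratification. Suppose that all bond angles are close to `π / 2`,
`π` or `3 π / 2`. Following bonds straight ahead decomposes the bond graph into strata, two
through every point, so that a configuration of `N` points with `K` strata has `2 N - K` bonds.
The directions are divided into sectors of opening `π / 10`, and a stratum is cut wherever it
passes from one sector to another; for a suitable rotation of the sectors the number of cuts is at
most the total turning of the strata divided by `π / 10` (`exists_translate_separating_le`), which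
is at most half of the angular energy since `v₃` has a large slope at `π`. After cutting, every
stratum stays in a convex cone, hence it is not closed and two strata meet at most once; the cones
of meeting strata are almost orthogonal, so no three strata meet pairwise; and strata that end at
the substrate are almost vertical and do not meet each other (`exists_strata`). So the strata are
the vertices of a triangle-free graph with at least `N` edges, in which the `s` strata attached to
the substrate are independent. By Mantel's argument (`exists_card_le_mul_of_triangleFree`) one has
`N ≤ a b` with `a + b = K` and `a ≥ s`, and the energy is at least
`-2 N + a + b - β s ≥ -2 N + m_β(N) / 2` (`half_normalizedMinEnergy_le`).

A configuration with a close pair or with a bad bond angle contains a point whose removal lowers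
the energy strictly: a point of the most crowded cell (`exists_pos_of_close`), or a point of the
bad angle by a packing bound (`exists_erase_lt_of_bad_angle`). As the lower bound does not
increase with `N`, such configurations are dealt with by induction (`crystallization_real`).

In the case of equality all bonds have length one and all bond angles are exact multiples of a
right angle, and the chain of inequalities for `a`, `b` and `s` gives `s ≥ N / h_*`. Points that
are not connected to the lattice through bonds form a separate cluster, which is excluded by the
strict superadditivity of the bound (`normalizedMinEnergy_add_lt`, `mem_squareLattice_of_exact`).

The argument works for every `N ≥ 1`.
-/

namespace SubstrateCrystal

/-! ### The optimal aspect ratio -/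

theorem normalizedMinEnergy_le (β : ℝ) {N h : ℕ} (h1 : 1 ≤ h) (h2 : h ≤ N) :
    normalizedMinEnergy β N ≤ heightEnergy β N h :=
  (isLeast_normalizedMinEnergy β (h1.trans h2)).2 ⟨h, ⟨h1, h2⟩, rfl⟩

theorem exists_heightEnergy_eq (β : ℝ) {N : ℕ} (hN : 1 ≤ N) :
    ∃ h, 1 ≤ h ∧ h ≤ N ∧ heightEnergy β N h = normalizedMinEnergy β N := by
  obtain ⟨h, hh, he⟩ := (isLeast_normalizedMinEnergy β hN).1
  exact ⟨h, hh.1, hh.2, he⟩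

theorem ceil_div_le {N h w : ℕ} (hh : 1 ≤ h) (hw : N ≤ w * h) :
    ((⌈(N : ℝ) / (h : ℝ)⌉ : ℤ) : ℝ) ≤ w := by
  have h0 : (0 : ℝ) < h := by exact_mod_cast hh
  have : ⌈(N : ℝ) / (h : ℝ)⌉ ≤ (w : ℤ) := by
    rw [Int.ceil_le, div_le_iff₀ h0]
    exact_mod_cast hw
  exact_mod_cast this

theorem exists_nat_ceil_div {N h : ℕ} (hh : 1 ≤ h) :
    ∃ w : ℕ, ((⌈(N : ℝ) / (h : ℝ)⌉ : ℤ) : ℝ) = w ∧ N ≤ w * h ∧ w ≤ N := by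
  have h0 : (0 : ℝ) < h := by exact_mod_cast hh
  have hnn : (0 : ℤ) ≤ ⌈(N : ℝ) / (h : ℝ)⌉ := Int.ceil_nonneg (by positivity)
  obtain ⟨w, hw⟩ := Int.eq_ofNat_of_zero_le hnn
  refine ⟨w, by rw [hw]; simp, ?_, ?_⟩
  · have := Int.le_ceil ((N : ℝ) / (h : ℝ))
    rw [hw, div_le_iff₀ h0] at this
    exact_mod_cast this
  · have h2 := ceil_div_le (N := N) (w := N) hh (Nat.le_mul_of_pos_right _ hh)
    rw [hw] at h2
    exact_mod_cast h2

/-- The slicing bound for weak adhesion: `w` columns and `h` rows that together hold `N` points cost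
at least `m_β(N) / 2`. -/
theorem normalizedMinEnergy_le_of_le_mul {β : ℝ} (hβ : β ≤ 1) {N w h : ℕ} (hN : 1 ≤ N)
    (hm : N ≤ w * h) :
    normalizedMinEnergy β N ≤ 2 * h + 2 * (1 - β) * w ∧
      (normalizedMinEnergy β N = 2 * h + 2 * (1 - β) * w → h ≤ optimalHeight β N) := by
  have hh : 1 ≤ h := Nat.one_le_iff_ne_zero.2 (by rintro rfl; simp at hm; omega)
  have hw : 1 ≤ w := Nat.one_le_iff_ne_zero.2 (by rintro rfl; simp at hm; omega)
  by_cases hle : h ≤ N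
  · have h1 := normalizedMinEnergy_le β hh hle
    have h2 : heightEnergy β N h ≤ 2 * h + 2 * (1 - β) * w := by
      unfold heightEnergy
      have := mul_le_mul_of_nonneg_left (ceil_div_le hh hm) (by linarith : (0 : ℝ) ≤ 2 * (1 - β))
      linarith
    exact ⟨h1.trans h2, fun he => (isGreatest_optimalHeight β hN).2 ⟨⟨hh, hle⟩, by linarith⟩⟩
  · have h1 := normalizedMinEnergy_le β hN le_rfl
    have h2 : heightEnergy β N N ≤ 2 * N + 2 * (1 - β) * (1 : ℕ) := by
      unfold heightEnergy
      have := mul_le_mul_of_nonneg_left (ceil_div_le hN (by simp : N ≤ 1 * N))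
        (by linarith : (0 : ℝ) ≤ 2 * (1 - β))
      linarith
    have h3 : (N : ℝ) + 1 ≤ h := by exact_mod_cast not_le.1 hle
    have h4 : (1 : ℝ) ≤ w := by exact_mod_cast hw
    have h5 : 2 * (1 - β) * (1 : ℝ) ≤ 2 * (1 - β) * w :=
      mul_le_mul_of_nonneg_left h4 (by linarith)
    push_cast at h2
    exact ⟨by linarith, fun he => by linarith⟩

theorem normalizedMinEnergy_eq_of_one_lt {β : ℝ} (hβ : 1 < β) {N : ℕ} (hN : 1 ≤ N) :
    normalizedMinEnergy β N = 2 + 2 * (1 - β) * N := by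
  apply le_antisymm
  · have := normalizedMinEnergy_le β le_rfl hN
    unfold heightEnergy at this
    simpa using this
  · obtain ⟨h, h1, h2, he⟩ := exists_heightEnergy_eq β hN
    rw [← he]
    unfold heightEnergy
    obtain ⟨w, hw, -, hwN⟩ := exists_nat_ceil_div (N := N) h1
    rw [hw]
    have h3 : (1 : ℝ) ≤ h := by exact_mod_cast h1
    have h4 : (w : ℝ) ≤ N := by exact_mod_cast hwN
    nlinarith

/-- If `N` points are cut into `w` strata of one kind and `h` of the other, `s` of the former being
attached to the substrate, then `w + h - β s` is at least `m_β(N) / 2`; in the case of equality at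
least `N / h_*` points are attached. -/
theorem half_normalizedMinEnergy_le {β : ℝ} (hβ : 0 < β) {N w h s : ℕ} (hN : 1 ≤ N)
    (hm : N ≤ w * h) (hs : s ≤ w) (hsN : s ≤ N) :
    1 / 2 * normalizedMinEnergy β N ≤ w + h - β * s ∧
      (1 / 2 * normalizedMinEnergy β N = w + h - β * s → (N : ℝ) / optimalHeight β N ≤ s) := by
  have hh : 1 ≤ h := Nat.one_le_iff_ne_zero.2 (by rintro rfl; simp at hm; omega)
  have hsR : (s : ℝ) ≤ w := by exact_mod_cast hs
  have hsNR : (s : ℝ) ≤ N := by exact_mod_cast hsN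
  have hhR : (1 : ℝ) ≤ h := by exact_mod_cast hh
  have hopt := (isGreatest_optimalHeight β hN).1.1.1
  have hoptR : (1 : ℝ) ≤ optimalHeight β N := by exact_mod_cast hopt
  rcases le_or_gt β 1 with h1 | h1
  · obtain ⟨h2, h3⟩ := normalizedMinEnergy_le_of_le_mul h1 hN hm
    have h4 : β * s ≤ β * w := mul_le_mul_of_nonneg_left hsR hβ.le
    refine ⟨by linarith, fun he => ?_⟩
    have h5 : (w : ℝ) ≤ s := le_of_mul_le_mul_left (by linarith : β * w ≤ β * s) hβ
    have h6 : (h : ℝ) ≤ optimalHeight β N := by exact_mod_cast h3 (by linarith)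
    rw [div_le_iff₀ (by linarith)]
    calc (N : ℝ) ≤ w * h := by exact_mod_cast hm
      _ ≤ s * optimalHeight β N := by gcongr
  · rw [normalizedMinEnergy_eq_of_one_lt h1 hN]
    refine ⟨by nlinarith, fun he => ?_⟩
    have h5 : (N : ℝ) ≤ s := by nlinarith
    exact (div_le_self (by positivity) hoptR).trans h5

/-- The lower bound `-2 N + m_β(N) / 2` for the energy does not increase with `N`. -/
theorem normalizedMinEnergy_succ_le {β : ℝ} (hβ : 0 < β) {N : ℕ} (hN : 1 ≤ N) :
    normalizedMinEnergy β (N + 1) ≤ normalizedMinEnergy β N + 4 := by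
  rcases le_or_gt β 1 with h1 | h1
  · obtain ⟨h, h2, h3, he⟩ := exists_heightEnergy_eq β hN
    rw [← he]
    unfold heightEnergy
    obtain ⟨w, hw, hwh, -⟩ := exists_nat_ceil_div (N := N) h2
    rw [hw]
    have := (normalizedMinEnergy_le_of_le_mul h1 (N := N + 1) (w := w + 1) (h := h) (by omega)
      (by nlinarith)).1
    push_cast at this
    nlinarith
  · rw [normalizedMinEnergy_eq_of_one_lt h1 hN, normalizedMinEnergy_eq_of_one_lt h1 (by omega)]
    push_cast
    nlinarith

theorem normalizedMinEnergy_one (β : ℝ) : normalizedMinEnergy β 1 = 2 + 2 * (1 - β) := by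
  obtain ⟨h, h2, h3, he⟩ := exists_heightEnergy_eq β le_rfl
  obtain rfl : h = 1 := by omega
  rw [← he]
  simp [heightEnergy]

/-- Two clusters are strictly more expensive than a single one. -/
theorem normalizedMinEnergy_add_lt {β : ℝ} {M N : ℕ} (hM : 1 ≤ M) (hN : 1 ≤ N) :
    normalizedMinEnergy β (M + N) < normalizedMinEnergy β M + normalizedMinEnergy β N := by
  rcases le_or_gt β 1 with h1 | h1
  · obtain ⟨h, h2, h3, he⟩ := exists_heightEnergy_eq β hM
    obtain ⟨k, k2, k3, ke⟩ := exists_heightEnergy_eq β hN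
    rw [← he, ← ke]
    unfold heightEnergy
    obtain ⟨w, hw, hwh, -⟩ := exists_nat_ceil_div (N := M) h2
    obtain ⟨v, hv, hvk, -⟩ := exists_nat_ceil_div (N := N) k2
    rw [hw, hv]
    have := (normalizedMinEnergy_le_of_le_mul h1 (N := M + N) (w := w + v) (h := max h k) (by omega)
      (by nlinarith [le_max_left h k, le_max_right h k])).1
    have hmax : ((max h k : ℕ) : ℝ) + 1 ≤ h + k := by
      have : max h k + 1 ≤ h + k := by omega
      exact_mod_cast this
    push_cast at this hmax
    nlinarith
  · rw [normalizedMinEnergy_eq_of_one_lt h1 hM, normalizedMinEnergy_eq_of_one_lt h1 hN,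
      normalizedMinEnergy_eq_of_one_lt h1 (by omega)]
    push_cast
    linarith

/-! ### Two facts on finite graphs and relations -/

/-- A form of Mantel's theorem. In a finite triangle-free graph on `V` with an independent set `S`,
the number of edges, here indexed by `X`, is at most `a (|V| - a)` for some `a ≥ |S|`: take for `a`
the independence number, which bounds all degrees because neighbourhoods are independent. -/
theorem exists_card_le_mul_of_triangleFree {τ χ : Type*} [DecidableEq τ] (V S : Finset τ)
    (r : τ → τ → Prop) (hsymm : ∀ a b, r a b → r b a)
    (htri : ∀ a b c, r a b → r a c → ¬ r b c) (hSV : S ⊆ V) (hS : ∀ a ∈ S, ∀ b ∈ S, ¬ r a b)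
    (X : Finset χ) (c₁ c₂ : χ → τ) (h₁ : ∀ x ∈ X, c₁ x ∈ V) (h₂ : ∀ x ∈ X, c₂ x ∈ V)
    (hr : ∀ x ∈ X, r (c₁ x) (c₂ x))
    (hinj : ∀ x ∈ X, ∀ y ∈ X, (c₁ x = c₁ y ∧ c₂ x = c₂ y ∨ c₁ x = c₂ y ∧ c₂ x = c₁ y) → x = y) :
    ∃ a b, S.card ≤ a ∧ a + b = V.card ∧ X.card ≤ a * b := by
  classical
  obtain ⟨Ind, hInd⟩ : ∃ Ind : Finset τ → Prop, ∀ I, Ind I ↔ ∀ a ∈ I, ∀ b ∈ I, ¬ r a b :=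
    ⟨_, fun _ => Iff.rfl⟩
  have hmem : ∀ I, I ∈ V.powerset.filter Ind ↔ I ⊆ V ∧ ∀ a ∈ I, ∀ b ∈ I, ¬ r a b := fun I => by
    rw [Finset.mem_filter, Finset.mem_powerset, hInd]
  obtain ⟨I, hI, hmax⟩ := (V.powerset.filter Ind).exists_max_image Finset.card
    ⟨S, (hmem S).2 ⟨hSV, hS⟩⟩
  obtain ⟨hIV, hI⟩ := (hmem I).1 hI
  have hdeg : ∀ v, (V.filter (r v)).card ≤ I.card := fun v => hmax _ <| (hmem _).2
    ⟨Finset.filter_subset _ _, fun a ha b hb =>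
      htri v a b (Finset.mem_filter.1 ha).2 (Finset.mem_filter.1 hb).2⟩
  refine ⟨I.card, (V \ I).card, hmax _ ((hmem S).2 ⟨hSV, hS⟩), ?_, ?_⟩
  · rw [add_comm, Finset.card_sdiff_add_card_eq_card hIV]
  · -- every edge has an end outside `I`
    let f : χ → (_ : τ) × τ := fun x => if c₁ x ∈ I then ⟨c₂ x, c₁ x⟩ else ⟨c₁ x, c₂ x⟩
    calc X.card ≤ ((V \ I).sigma fun v => V.filter (r v)).card := by
          refine Finset.card_le_card_of_injOn f ?_ ?_
          · intro x hx
            have hx' : x ∈ X := hx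
            by_cases h : c₁ x ∈ I
            · have : c₂ x ∉ I := fun h' => hI _ h _ h' (hr x hx')
              simp [f, h, this, h₁ x hx', h₂ x hx', hsymm _ _ (hr x hx')]
            · simp [f, h, h₁ x hx', h₂ x hx', hr x hx']
          · intro x hx y hy hxy
            apply hinj x hx y hy
            by_cases h : c₁ x ∈ I <;> by_cases h' : c₁ y ∈ I <;> simp [f, h, h'] at hxy <;> tauto
      _ = ∑ v ∈ V \ I, (V.filter (r v)).card := Finset.card_sigma _ _
      _ ≤ ∑ _v ∈ V \ I, I.card := Finset.sum_le_sum fun v _ => hdeg v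
      _ = I.card * (V \ I).card := by rw [Finset.sum_const, smul_eq_mul, mul_comm]

/-- In a finite set, following an acyclic relation backwards ends at an element without
predecessor. -/
theorem exists_root {τ : Type*} (E : Finset τ) (r : τ → τ → Prop) (hE : ∀ a b, r a b → a ∈ E)
    (hirr : ∀ a, ¬ Relation.TransGen r a a) {e : τ} (he : e ∈ E) :
    ∃ i ∈ E, Relation.ReflTransGen r i e ∧ ∀ j, ¬ r j i := by
  classical
  by_contra! hcon
  let A := E.filter fun i => Relation.ReflTransGen r i e
  have : IsTrans τ (Relation.TransGen r) := inferInstance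
  have : Std.Irrefl (Relation.TransGen r) := ⟨hirr⟩
  let q : A → A → Prop := fun a b => Relation.TransGen r a.1 b.1
  have : IsTrans A q := ⟨fun a b c h h' => Relation.TransGen.trans h h'⟩
  have : Std.Irrefl q := ⟨fun a => hirr a.1⟩
  have wf : WellFounded q := Finite.wellFounded_of_trans_of_irrefl q
  obtain ⟨m, -, hm⟩ := wf.has_min Set.univ
    ⟨⟨e, Finset.mem_filter.2 ⟨he, Relation.ReflTransGen.refl⟩⟩, trivial⟩
  obtain ⟨hmE, hme⟩ := Finset.mem_filter.1 m.2
  obtain ⟨j, hj⟩ := hcon m.1 hmE hme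
  exact hm ⟨j, Finset.mem_filter.2 ⟨hE _ _ hj, Relation.ReflTransGen.head hj hme⟩⟩ trivial
    (Relation.TransGen.single hj)

/-! ### Sectors of directions -/

open MeasureTheory in
theorem integral_floor_sub (a : ℝ) : ∫ t in (0 : ℝ)..1, (⌊a - t⌋ : ℝ) = a - 1 := by
  have hfr : ∫ t in (0 : ℝ)..1, Int.fract (a - t) = 1 / 2 := by
    rw [intervalIntegral.integral_comp_sub_left (fun x => Int.fract x) a]
    have hper : Function.Periodic (Int.fract : ℝ → ℝ) 1 := fun x => Int.fract_add_one x
    have := hper.intervalIntegral_add_eq (a - 1) 0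
    rw [sub_add_cancel, zero_add] at this
    rw [sub_zero, this]
    have : ∫ x in (0 : ℝ)..1, Int.fract x = ∫ x in (0 : ℝ)..1, x := by
      apply intervalIntegral.integral_congr_ae
      have h1 : ∀ᵐ x : ℝ, x ≠ 1 := by simp [ae_iff]
      filter_upwards [h1] with x hx hmem
      rw [Set.uIoc_of_le zero_le_one] at hmem
      exact Int.fract_eq_self.2 ⟨hmem.1.le, lt_of_le_of_ne hmem.2 hx⟩
    rw [this]
    simp
  have hint : IntervalIntegrable (fun t : ℝ => (⌊a - t⌋ : ℝ)) volume 0 1 := by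
    apply Antitone.intervalIntegrable
    intro s t hst
    exact Int.cast_le.2 (Int.floor_mono (sub_le_sub_left hst a))
  have h2 : ∫ t in (0 : ℝ)..1, Int.fract (a - t)
      = ∫ t in (0 : ℝ)..1, ((a - t) - (⌊a - t⌋ : ℝ)) := rfl
  rw [intervalIntegral.integral_sub (f := fun t => a - t)
    ((continuous_const.sub continuous_id).intervalIntegrable _ _) hint] at h2
  rw [intervalIntegral.integral_sub (by simp) (by simp)] at h2
  simp at h2 hfr
  linarith

open MeasureTheory in
/-- A random translate of `ℤ` separates `a i` from `b i` with probability at most `|a i - b i|`; so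
some translate separates at most `∑ |a i - b i|` of the pairs. -/
theorem exists_translate_separating_le {ι : Type*} (T : Finset ι) (a b : ι → ℝ) :
    ∃ t : ℝ, 0 ≤ t ∧ t ≤ 1 ∧
      ((T.filter fun i => ⌊a i - t⌋ ≠ ⌊b i - t⌋).card : ℝ) ≤ ∑ i ∈ T, |a i - b i| := by
  have hint : ∀ c : ℝ, IntervalIntegrable (fun t : ℝ => (⌊c - t⌋ : ℝ)) volume 0 1 := by
    intro c
    apply Antitone.intervalIntegrable
    intro s t hst
    exact Int.cast_le.2 (Int.floor_mono (sub_le_sub_left hst c))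
  let G : ℝ → ℝ := fun t =>
    ∑ i ∈ T, ((⌊max (a i) (b i) - t⌋ : ℝ) - (⌊min (a i) (b i) - t⌋ : ℝ))
  have hG : ∫ t in (0 : ℝ)..1, G t = ∑ i ∈ T, |a i - b i| := by
    rw [intervalIntegral.integral_finsetSum fun i _ => (hint _).sub (hint _)]
    refine Finset.sum_congr rfl fun i _ => ?_
    rw [intervalIntegral.integral_sub (hint _) (hint _), integral_floor_sub, integral_floor_sub,
      sub_sub_sub_cancel_right, max_sub_min_eq_abs']
  have hGi : IntegrableOn G (Set.Ioc 0 1) := by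
    have : IntervalIntegrable G volume 0 1 := by
      have := IntervalIntegrable.sum T (f := fun i t => ((⌊max (a i) (b i) - t⌋ : ℝ) -
        (⌊min (a i) (b i) - t⌋ : ℝ))) fun i _ => (hint _).sub (hint _)
      simpa only [G, ← Finset.sum_fn] using this
    exact (intervalIntegrable_iff_integrableOn_Ioc_of_le zero_le_one).1 this
  obtain ⟨t, ht, hle⟩ := exists_le_setAverage (s := Set.Ioc (0 : ℝ) 1) (μ := volume) (by simp)
    (by simp) hGi
  refine ⟨t, ht.1.le, ht.2, ?_⟩
  rw [setAverage_eq, ← intervalIntegral.integral_of_le zero_le_one, hG] at hle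
  refine le_trans ?_ (hle.trans_eq (by simp))
  rw [Finset.card_filter]
  push_cast
  refine Finset.sum_le_sum fun i _ => ?_
  have hmono : ⌊min (a i) (b i) - t⌋ ≤ ⌊max (a i) (b i) - t⌋ :=
    Int.floor_mono (sub_le_sub_right (min_le_max) t)
  split_ifs with h
  · have : ⌊min (a i) (b i) - t⌋ + 1 ≤ ⌊max (a i) (b i) - t⌋ := by
      rcases le_total (a i) (b i) with h' | h' <;> simp only [h', min_eq_left, min_eq_right,
        max_eq_left, max_eq_right] at hmono ⊢ <;> omega
    have h2 : ((⌊min (a i) (b i) - t⌋ : ℤ) : ℝ) + 1 ≤ (⌊max (a i) (b i) - t⌋ : ℤ) := by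
      exact_mod_cast this
    linarith
  · have h2 : ((⌊min (a i) (b i) - t⌋ : ℤ) : ℝ) ≤ (⌊max (a i) (b i) - t⌋ : ℤ) := by
      exact_mod_cast hmono
    linarith

/-- The index of the sector of opening `π / 10` (counted from the direction `t π / 10`) that
contains the direction of `w`. Only its value modulo `20` is meaningful; modulo `10` it is the
sector of the line through `0` and `w`. -/
noncomputable def sector (t : ℝ) (w : ℂ) : ℤ := ⌊w.arg * (10 / Real.pi) - t⌋

theorem exists_arg_div (w w' : ℂ) (hw : w ≠ 0) (hw' : w' ≠ 0) :
    ∃ n : ℤ, (w / w').arg = w.arg - w'.arg + 2 * Real.pi * n := by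
  have h := Complex.arg_div_coe_angle hw hw'
  rw [← Real.Angle.coe_sub, Real.Angle.angle_eq_iff_two_pi_dvd_sub] at h
  obtain ⟨n, hn⟩ := h
  exact ⟨n, by linarith⟩

theorem sector_neg (t : ℝ) {w : ℂ} (hw : w ≠ 0) : (sector t (-w) - sector t w) % 20 = 10 := by
  have h := Complex.arg_neg_coe_angle hw
  rw [← Real.Angle.coe_add, Real.Angle.angle_eq_iff_two_pi_dvd_sub] at h
  obtain ⟨n, hn⟩ := h
  have hpi := Real.pi_ne_zero
  have : (-w).arg * (10 / Real.pi) - t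
      = w.arg * (10 / Real.pi) - t + ((10 + 20 * n : ℤ) : ℝ) := by
    rw [show (-w).arg = w.arg + Real.pi + 2 * Real.pi * n by linarith]
    push_cast
    field_simp
    ring
  unfold sector
  rw [this, Int.floor_add_intCast]
  omega

theorem im_mul_exp (w : ℂ) (c : ℝ) :
    (w * Complex.exp (((-c : ℝ) : ℂ) * Complex.I)).im = ‖w‖ * Real.sin (w.arg - c) := by
  conv_lhs => rw [← Complex.norm_mul_exp_arg_mul_I w, mul_assoc, ← Complex.exp_add, ← add_mul,
    ← Complex.ofReal_add, Complex.im_ofReal_mul, Complex.exp_ofReal_mul_I_im]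
  rw [sub_eq_add_neg]

/-- Sectors are intersections of two half planes. -/
theorem sector_emod_eq_iff (t : ℝ) {w : ℂ} (hw : w ≠ 0) (k : ℤ) :
    (sector t w - k) % 20 = 0 ↔
      0 ≤ (w * Complex.exp (((-((k + t) * (Real.pi / 10)) : ℝ) : ℂ) * Complex.I)).im ∧
      (w * Complex.exp (((-((k + 1 + t) * (Real.pi / 10)) : ℝ) : ℂ) * Complex.I)).im < 0 := by
  have hpi := Real.pi_pos
  have hnorm : 0 < ‖w‖ := norm_pos_iff.2 hw
  rw [im_mul_exp, im_mul_exp, mul_nonneg_iff_of_pos_left hnorm, ← neg_pos, ← mul_neg,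
    mul_pos_iff_of_pos_left hnorm, neg_pos]
  obtain ⟨f, hf⟩ : ∃ f, f = Int.fract (w.arg * (10 / Real.pi) - t) := ⟨_, rfl⟩
  have hf0 : 0 ≤ f := hf ▸ Int.fract_nonneg _
  have hf1 : f < 1 := hf ▸ Int.fract_lt_one _
  have harg : w.arg = (sector t w + f + t) * (Real.pi / 10) := by
    have h : (sector t w : ℝ) + f + t = w.arg * (10 / Real.pi) := by
      have := Int.floor_add_fract (w.arg * (10 / Real.pi) - t)
      rw [← hf] at this
      unfold sector
      linarith
    rw [h]
    field_simp
  obtain ⟨j, hj⟩ : ∃ j, j = (sector t w - k) % 20 := ⟨_, rfl⟩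
  obtain ⟨m, hm⟩ : ∃ m, m = (sector t w - k) / 20 := ⟨_, rfl⟩
  have hjm : sector t w - k = j + 20 * m := by omega
  have hjmR : (sector t w : ℝ) - k = j + 20 * m := by exact_mod_cast hjm
  have e1 : w.arg - (k + t) * (Real.pi / 10) = (j + f) * (Real.pi / 10) + m * (2 * Real.pi) := by
    rw [harg]; linear_combination (Real.pi / 10) * hjmR
  have e2 : w.arg - (k + 1 + t) * (Real.pi / 10)
      = (j + f - 1) * (Real.pi / 10) + m * (2 * Real.pi) := by
    rw [harg]; linear_combination (Real.pi / 10) * hjmR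
  rw [e1, e2, Real.sin_add_int_mul_two_pi, Real.sin_add_int_mul_two_pi, ← hj]
  have hj0 : 0 ≤ j := by omega
  have hj20 : j < 20 := by omega
  constructor
  · intro h0
    rw [h0]
    refine ⟨Real.sin_nonneg_of_nonneg_of_le_pi ?_ ?_, Real.sin_neg_of_neg_of_neg_pi_lt ?_ ?_⟩ <;>
      push_cast <;> nlinarith
  · rintro ⟨h1, h2⟩
    by_contra hne
    have hj1 : 1 ≤ j := by omega
    have hj1R : (1 : ℝ) ≤ j := by exact_mod_cast hj1
    by_cases hj10 : j ≤ 10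
    · have hj10R : (j : ℝ) ≤ 10 := by exact_mod_cast hj10
      have := Real.sin_nonneg_of_nonneg_of_le_pi (x := (j + f - 1) * (Real.pi / 10))
        (by apply mul_nonneg <;> linarith) (by nlinarith)
      linarith
    · have hj11R : (11 : ℝ) ≤ j := by exact_mod_cast (by omega : 11 ≤ j)
      have hj19R : (j : ℝ) ≤ 19 := by exact_mod_cast (by omega : j ≤ 19)
      have := Real.sin_neg_of_neg_of_neg_pi_lt (x := (j + f) * (Real.pi / 10) - 2 * Real.pi)
        (by nlinarith) (by nlinarith)
      rw [Real.sin_sub_two_pi] at this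
      linarith

/-- Sectors are convex cones. -/
theorem sector_add (t : ℝ) {w w' : ℂ} (hw : w ≠ 0) (hw' : w' ≠ 0) (k : ℤ)
    (h : (sector t w - k) % 20 = 0) (h' : (sector t w' - k) % 20 = 0) :
    w + w' ≠ 0 ∧ (sector t (w + w') - k) % 20 = 0 := by
  rw [sector_emod_eq_iff t hw] at h
  rw [sector_emod_eq_iff t hw'] at h'
  have hne : w + w' ≠ 0 := by
    intro h0
    have h1 := h.2
    have h2 := h'.2
    rw [eq_neg_of_add_eq_zero_right h0, neg_mul, Complex.neg_im] at h2
    linarith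
  refine ⟨hne, ?_⟩
  rw [sector_emod_eq_iff t hne, add_mul w, add_mul w, Complex.add_im, Complex.add_im]
  exact ⟨add_nonneg h.1 h'.1, add_neg h.2 h'.2⟩

/-! ### Strata -/

/-- The differences of sector indices, modulo `20`, of two directions that enclose a
small perturbation of a nonzero multiple of a right angle. -/
def IsRightTurn (d : ℤ) : Prop :=
  (4 ≤ d % 20 ∧ d % 20 ≤ 6) ∨ (9 ≤ d % 20 ∧ d % 20 ≤ 11) ∨ (14 ≤ d % 20 ∧ d % 20 ≤ 16)

/-- The difference of sector indices, modulo `20`, of two almost opposite directions whose lines lie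
in different sectors. -/
def IsBroken (d : ℤ) : Prop := d % 20 = 9 ∨ d % 20 = 11

/-- The neighbours of a point, described by the sector indices `f`, lie on two lines. The labels
`l₁, l₂` are the sectors of these lines; a neighbour whose sector is neither of them is
one end of a broken straight line. A label can be made to agree with the sector of one prescribed
neighbour. -/
theorem exists_labels {τ : Type*} (n s : Finset τ) (f : τ → ℤ) (hs : s ⊆ n)
    (hs1 : ∀ y ∈ s, ∀ z ∈ s, y = z)
    (hf : ∀ y ∈ n, ∀ z ∈ n, y ≠ z → IsRightTurn (f y - f z)) :
    ∃ l₁ l₂ : ℤ, 0 ≤ l₁ ∧ l₁ < 10 ∧ 0 ≤ l₂ ∧ l₂ < 10 ∧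
      4 ≤ (l₁ - l₂) % 10 ∧ (l₁ - l₂) % 10 ≤ 6 ∧ (∀ z ∈ s, f z % 10 = l₁ ∨ f z % 10 = l₂) ∧
      ∀ y ∈ n, ¬ (f y % 10 = l₁ ∨ f y % 10 = l₂) → ∃ z ∈ n, y ≠ z ∧ IsBroken (f y - f z) := by
  rcases n.eq_empty_or_nonempty with rfl | hn
  · exact ⟨0, 5, by norm_num, by norm_num, by norm_num, by norm_num, by norm_num, by norm_num,
      fun z hz => absurd (hs hz) (Finset.notMem_empty z),
      fun z hz => absurd hz (Finset.notMem_empty z)⟩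
  obtain ⟨y₀, hy₀, hy₀s⟩ : ∃ y₀ ∈ n, ∀ z ∈ s, z = y₀ := by
    rcases s.eq_empty_or_nonempty with rfl | ⟨z, hz⟩
    · obtain ⟨y, hy⟩ := hn
      exact ⟨y, hy, fun z hz => absurd hz (Finset.notMem_empty z)⟩
    · exact ⟨z, hs hz, fun z' hz' => hs1 _ hz' _ hz⟩
  have hfD : ∀ y ∈ n, ∀ z ∈ n, y ≠ z → (4 ≤ (f y - f z) % 20 ∧ (f y - f z) % 20 ≤ 6) ∨
    (9 ≤ (f y - f z) % 20 ∧ (f y - f z) % 20 ≤ 11) ∨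
    (14 ≤ (f y - f z) % 20 ∧ (f y - f z) % 20 ≤ 16) := hf
  by_cases h : ∃ y₁ ∈ n, 4 ≤ (f y₁ - f y₀) % 10 ∧ (f y₁ - f y₀) % 10 ≤ 6
  · obtain ⟨y₁, hy₁, h4, h6⟩ := h
    refine ⟨f y₀ % 10, f y₁ % 10, by omega, by omega, by omega, by omega, by omega, by omega,
      fun z hz => Or.inl (by rw [hy₀s z hz]), fun y hy hlab => ?_⟩
    have hne₀ : y ≠ y₀ := by rintro rfl; exact hlab (Or.inl rfl)
    have hne₁ : y ≠ y₁ := by rintro rfl; exact hlab (Or.inr rfl)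
    have h0 := hfD y hy y₀ hy₀ hne₀
    have h1 := hfD y hy y₁ hy₁ hne₁
    by_cases h9 : 9 ≤ (f y - f y₀) % 20 ∧ (f y - f y₀) % 20 ≤ 11
    · exact ⟨y₀, hy₀, hne₀, by unfold IsBroken; omega⟩
    · exact ⟨y₁, hy₁, hne₁, by unfold IsBroken; omega⟩
  · refine ⟨f y₀ % 10, (f y₀ + 5) % 10, by omega, by omega, by omega, by omega, by omega, by omega,
      fun z hz => Or.inl (by rw [hy₀s z hz]), fun y hy hlab => ?_⟩
    have hne₀ : y ≠ y₀ := by rintro rfl; exact hlab (Or.inl rfl)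
    have h0 := hfD y hy y₀ hy₀ hne₀
    have h1 : ¬ (4 ≤ (f y - f y₀) % 10 ∧ (f y - f y₀) % 10 ≤ 6) := fun h' => h ⟨y, hy, h'⟩
    exact ⟨y₀, hy₀, hne₀, by unfold IsBroken; omega⟩

open Relation in
/-- Stratification. In a bond graph with angles close to multiples of right angles every point lies
on two strata, the maximal monotone paths within one sector. Two strata meet at most once since
their displacements lie in different cones, no three strata meet pairwise since the directions of
meeting strata are almost orthogonal, and the strata that are attached to the substrate are almost
vertical and thus do not meet. Hence the points are at most as many as the crossings of `b` with `a`
strata, where the number `a + b` of all strata is determined by the number of bonds. -/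
theorem exists_strata (t : ℝ) (C : Finset ℂ) (nb sub : ℂ → Finset ℂ)
    (hnb : ∀ x ∈ C, nb x ⊆ C) (hself : ∀ x ∈ C, x ∉ nb x)
    (hsymm : ∀ x ∈ C, ∀ y ∈ nb x, x ∈ nb y) (hsub : ∀ x ∈ C, Disjoint (sub x) C)
    (hturn : ∀ x ∈ C, ∀ y ∈ nb x ∪ sub x, ∀ z ∈ nb x ∪ sub x, y ≠ z →
      IsRightTurn (sector t (y - x) - sector t (z - x)))
    (hvert : ∀ x ∈ C, ∀ z ∈ sub x, 13 ≤ sector t (z - x) % 20 ∧ sector t (z - x) % 20 ≤ 15)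
    (broken : Finset (ℂ × ℂ × ℂ))
    (hbroken : ∀ x ∈ C, ∀ y ∈ nb x ∪ sub x, ∀ z ∈ nb x ∪ sub x, y ≠ z →
      IsBroken (sector t (y - x) - sector t (z - x)) → (y, x, z) ∈ broken) :
    ∃ a b : ℕ, C.card ≤ a * b ∧ ∑ x ∈ C, (sub x).card ≤ a ∧ ∑ x ∈ C, (sub x).card ≤ C.card ∧
      2 * (a + b) + ∑ x ∈ C, (nb x).card ≤ 4 * C.card + 2 * broken.card := by
  classical
  have hne : ∀ x ∈ C, ∀ y ∈ nb x ∪ sub x, y - x ≠ 0 := by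
    intro x hx y hy h0
    rw [sub_eq_zero] at h0
    subst h0
    rcases Finset.mem_union.1 hy with h | h
    · exact hself _ hx h
    · exact Finset.disjoint_left.1 (hsub _ hx) h hx
  have hneg : ∀ x ∈ C, ∀ y ∈ nb x, (sector t (x - y) - sector t (y - x)) % 20 = 10 := by
    intro x hx y hy
    have := sector_neg t (hne x hx y (Finset.mem_union_left _ hy))
    rwa [neg_sub] at this
  have hinj : ∀ x ∈ C, ∀ y ∈ nb x ∪ sub x, ∀ z ∈ nb x ∪ sub x,
      (sector t (y - x) - sector t (z - x)) % 20 = 0 → y = z := by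
    intro x hx y hy z hz h
    by_contra hyz
    have := hturn x hx y hy z hz hyz
    unfold IsRightTurn at this
    omega
  have hsub1 : ∀ x ∈ C, ∀ y ∈ sub x, ∀ z ∈ sub x, y = z := by
    intro x hx y hy z hz
    by_contra hyz
    have := hturn x hx y (Finset.mem_union_right _ hy) z (Finset.mem_union_right _ hz) hyz
    have h1 := hvert x hx y hy
    have h2 := hvert x hx z hz
    unfold IsRightTurn at this
    omega
  have hlab : ∀ x : ℂ, ∃ l₁ l₂ : ℤ, x ∈ C → 0 ≤ l₁ ∧ l₁ < 10 ∧ 0 ≤ l₂ ∧ l₂ < 10 ∧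
      4 ≤ (l₁ - l₂) % 10 ∧ (l₁ - l₂) % 10 ≤ 6 ∧
      (∀ z ∈ sub x, sector t (z - x) % 10 = l₁ ∨ sector t (z - x) % 10 = l₂) ∧
      ∀ y ∈ nb x ∪ sub x, ¬ (sector t (y - x) % 10 = l₁ ∨ sector t (y - x) % 10 = l₂) →
        ∃ z ∈ nb x ∪ sub x, y ≠ z ∧ IsBroken (sector t (y - x) - sector t (z - x)) := by
    intro x
    by_cases hx : x ∈ C
    · obtain ⟨l₁, l₂, h⟩ := exists_labels (nb x ∪ sub x) (sub x) (fun y => sector t (y - x))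
        Finset.subset_union_right (hsub1 x hx) (hturn x hx)
      exact ⟨l₁, l₂, fun _ => h⟩
    · exact ⟨0, 0, fun h => absurd h hx⟩
  choose l₁ l₂ hl using hlab
  -- a point together with one of its two labels
  let E : Finset (ℂ × ℤ) := C.image (fun x => (x, l₁ x)) ∪ C.image (fun x => (x, l₂ x))
  have hE : ∀ x l, (x, l) ∈ E ↔ x ∈ C ∧ (l = l₁ x ∨ l = l₂ x) := by
    intro x l
    simp only [E, Finset.mem_union, Finset.mem_image, Prod.mk.injEq]
    constructor
    · rintro (⟨y, hy, rfl, rfl⟩ | ⟨y, hy, rfl, rfl⟩)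
      · exact ⟨hy, Or.inl rfl⟩
      · exact ⟨hy, Or.inr rfl⟩
    · rintro ⟨hx, rfl | rfl⟩
      · exact Or.inl ⟨x, hx, rfl, rfl⟩
      · exact Or.inr ⟨x, hx, rfl, rfl⟩
  have hElt : ∀ x l, (x, l) ∈ E → 0 ≤ l ∧ l < 10 := by
    intro x l h
    obtain ⟨hx, h⟩ := (hE x l).1 h
    have := hl x hx
    omega
  have hEcard : E.card = 2 * C.card := by
    rw [Finset.card_union_of_disjoint, Finset.card_image_of_injective, Finset.card_image_of_injective,
      two_mul]
    · intro x y h; exact (Prod.mk.inj h).1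
    · intro x y h; exact (Prod.mk.inj h).1
    · rw [Finset.disjoint_left]
      rintro e h h'
      obtain ⟨x, hx, rfl⟩ := Finset.mem_image.1 h
      obtain ⟨y, hy, h2⟩ := Finset.mem_image.1 h'
      obtain ⟨rfl, h2⟩ := Prod.mk.inj h2
      have := hl _ hx
      omega
  -- a step along a bond within the cone of the common label; as labels lie in `[0, 10)`, they single
  -- out one of the two orientations of the line
  let r : ℂ × ℤ → ℂ × ℤ → Prop := fun e e' => e.2 = e'.2 ∧ e ∈ E ∧ e' ∈ E ∧ e.1 ∈ nb e'.1 ∧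
    (sector t (e'.1 - e.1) - e.2) % 20 = 0
  have hrC : ∀ e, e ∈ E → e.1 ∈ C := fun e he => ((hE e.1 e.2).1 he).1
  have hruniq : Relator.RightUnique r := by
    rintro ⟨y, l⟩ ⟨x, l'⟩ ⟨x', l''⟩ ⟨h1, h2, h3, h4, h5⟩ ⟨h1', h2', h3', h4', h5'⟩
    simp only at h1 h1' h4 h4' h5 h5'
    subst h1 h1'
    have := hinj y (hrC _ h2) x (Finset.mem_union_left _ (hsymm x (hrC _ h3) y h4))
      x' (Finset.mem_union_left _ (hsymm x' (hrC _ h3') y h4')) (by omega)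
    rw [this]
  have hcone : ∀ e e', TransGen r e e' →
      e.2 = e'.2 ∧ e'.1 - e.1 ≠ 0 ∧ (sector t (e'.1 - e.1) - e.2) % 20 = 0 := by
    intro e e' h
    induction h with
    | single h =>
      obtain ⟨h1, h2, h3, h4, h5⟩ := h
      refine ⟨h1, ?_, h5⟩
      have := hne _ (hrC _ h3) _ (Finset.mem_union_left _ h4)
      rwa [← neg_sub, neg_ne_zero]
    | tail _ h ih =>
      rename_i b c _
      obtain ⟨h1, h2, h3, h4, h5⟩ := h
      obtain ⟨i1, i2, i3⟩ := ih
      have h0 := hne _ (hrC _ h3) _ (Finset.mem_union_left _ h4)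
      rw [← neg_sub, neg_ne_zero] at h0
      have := sector_add t i2 h0 e.2 i3 (by rw [i1]; exact h5)
      rw [sub_add_sub_cancel'] at this
      exact ⟨i1.trans h1, this.1, this.2⟩
  have hirr : ∀ e, ¬ TransGen r e e := fun e h => (hcone e e h).2.1 (sub_self _)
  -- strata are represented by their first elements
  let I := E.filter fun i => ∀ j, ¬ r j i
  have hroot : ∀ e, ∃ i, e ∈ E → i ∈ I ∧ ReflTransGen r i e := by
    intro e
    by_cases he : e ∈ E
    · obtain ⟨i, hi, hie, hi0⟩ := exists_root E r (fun a b h => h.2.1) hirr he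
      exact ⟨i, fun _ => ⟨Finset.mem_filter.2 ⟨hi, hi0⟩, hie⟩⟩
    · exact ⟨e, fun h => absurd h he⟩
  choose root hroot using hroot
  have hlabel : ∀ e e', ReflTransGen r e e' → e.2 = e'.2 := by
    intro e e' h
    rcases Relation.reflTransGen_iff_eq_or_transGen.1 h with h | h
    · rw [h]
    · exact (hcone _ _ h).1
  have hE1 : ∀ x ∈ C, (x, l₁ x) ∈ E := fun x hx => (hE _ _).2 ⟨hx, Or.inl rfl⟩
  have hE2 : ∀ x ∈ C, (x, l₂ x) ∈ E := fun x hx => (hE _ _).2 ⟨hx, Or.inr rfl⟩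
  -- two points of a stratum differ by a vector in its sector
  have hmeet : ∀ x y l l', x ≠ y → (x, l) ∈ E → (y, l') ∈ E → root (x, l) = root (y, l') →
      l = l' ∧ (sector t (y - x) - l) % 10 = 0 := by
    intro x y l l' hxy hx hy h
    have h1 := (hroot _ hx).2
    have h2 := (hroot _ hy).2
    rw [← h] at h2
    have hll : l = l' := (hlabel _ _ h1).symm.trans (hlabel _ _ h2)
    refine ⟨hll, ?_⟩
    have hne' : (x, l) ≠ (y, l') := fun h => hxy (Prod.mk.inj h).1
    rcases ReflTransGen.total_of_right_unique hruniq h1 h2 with h3 | h3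
    · rcases Relation.reflTransGen_iff_eq_or_transGen.1 h3 with h4 | h4
      · exact absurd h4.symm hne'
      · have := (hcone _ _ h4).2.2
        simp only at this
        omega
    · rcases Relation.reflTransGen_iff_eq_or_transGen.1 h3 with h4 | h4
      · exact absurd h4 hne'
      · have h5 := (hcone _ _ h4).2
        simp only at h5
        have h6 := sector_neg t h5.1
        rw [neg_sub] at h6
        omega
  let S : Finset (ℂ × ℤ) := (C.sigma sub).image fun p => (p.1, sector t (p.2 - p.1) % 10)
  have hScard : S.card = ∑ x ∈ C, (sub x).card := by
    rw [Finset.card_image_of_injOn, Finset.card_sigma]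
    rintro ⟨x, z⟩ h ⟨x', z'⟩ h' heq
    simp only [Finset.coe_sigma, Set.mem_sigma_iff, Finset.mem_coe] at h h'
    obtain ⟨rfl, -⟩ := Prod.mk.inj heq
    rw [hsub1 x h.1 z h.2 z' h'.2]
  have hSmem : ∀ e ∈ S, ∃ x ∈ C, ∃ z ∈ sub x, e = (x, sector t (z - x) % 10) := by
    intro e he
    obtain ⟨⟨x, z⟩, hp, rfl⟩ := Finset.mem_image.1 he
    rw [Finset.mem_sigma] at hp
    exact ⟨x, hp.1, z, hp.2, rfl⟩
  have hSI : S ⊆ I := by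
    intro e he
    obtain ⟨x, hx, z, hz, rfl⟩ := hSmem e he
    have hzE : (x, sector t (z - x) % 10) ∈ E := (hE _ _).2 ⟨hx, (hl x hx).2.2.2.2.2.2.1 z hz⟩
    refine Finset.mem_filter.2 ⟨hzE, ?_⟩
    -- the substrate bond already occupies the place of a predecessor
    rintro ⟨y, l⟩ ⟨h1, h2, h3, h4, h5⟩
    simp only at h1 h4 h5
    have h6 := hneg x hx y h4
    have h7 := hvert x hx z hz
    have := hinj x hx y (Finset.mem_union_left _ h4) z (Finset.mem_union_right _ hz) (by omega)
    subst this
    exact Finset.disjoint_left.1 (hsub x hx) hz (hnb x hx h4)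
  obtain ⟨a, b, hSa, hab, hC⟩ := exists_card_le_mul_of_triangleFree I S
    (fun e e' => 4 ≤ (e.2 - e'.2) % 10 ∧ (e.2 - e'.2) % 10 ≤ 6)
    (fun e e' h => by omega) (fun e e' e'' h h' => by omega) hSI
    (by
      intro e he e' he'
      obtain ⟨x, hx, z, hz, rfl⟩ := hSmem e he
      obtain ⟨x', hx', z', hz', rfl⟩ := hSmem e' he'
      have h1 := hvert x hx z hz
      have h2 := hvert x' hx' z' hz'
      simp only
      omega)
    C (fun x => root (x, l₁ x)) (fun x => root (x, l₂ x))
    (fun x hx => (hroot _ (hE1 x hx)).1) (fun x hx => (hroot _ (hE2 x hx)).1)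
    (by
      intro x hx
      have h1 := hlabel _ _ (hroot _ (hE1 x hx)).2
      have h2 := hlabel _ _ (hroot _ (hE2 x hx)).2
      have := hl x hx
      simp only at h1 h2 ⊢
      rw [h1, h2]
      omega)
    (by
      intro x hx y hy h
      by_contra hxy
      have := hl x hx
      rcases h with ⟨h1, h2⟩ | ⟨h1, h2⟩
      · have h3 := hmeet x y _ _ hxy (hE1 x hx) (hE1 y hy) h1
        have h4 := hmeet x y _ _ hxy (hE2 x hx) (hE2 y hy) h2
        omega
      · have h3 := hmeet x y _ _ hxy (hE1 x hx) (hE2 y hy) h1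
        have h4 := hmeet x y _ _ hxy (hE2 x hx) (hE1 y hy) h2
        omega)
  refine ⟨a, b, hC, hScard ▸ hSa, ?_, ?_⟩
  · calc ∑ x ∈ C, (sub x).card ≤ ∑ _x ∈ C, 1 :=
          Finset.sum_le_sum fun x hx => Finset.card_le_one.2 (hsub1 x hx)
      _ = C.card := by simp
  · -- count the bonds, each of them twice in `A`
    rw [hab]
    let lab : (_ : ℂ) × ℂ → Prop := fun p =>
      sector t (p.2 - p.1) % 10 = l₁ p.1 ∨ sector t (p.2 - p.1) % 10 = l₂ p.1
    let up : (_ : ℂ) × ℂ → Prop := fun p => sector t (p.1 - p.2) % 20 < 10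
    let sw : (_ : ℂ) × ℂ → (_ : ℂ) × ℂ := fun p => ⟨p.2, p.1⟩
    have hsw : Function.Injective sw := by
      rintro ⟨x, y⟩ ⟨x', y'⟩ h
      simp only [sw, Sigma.mk.injEq, heq_eq_eq] at h
      rw [h.1, h.2]
    let A := C.sigma nb
    have hA : ∀ x y, (⟨x, y⟩ : (_ : ℂ) × ℂ) ∈ A ↔ x ∈ C ∧ y ∈ nb x := fun x y => by
      simp only [A, Finset.mem_sigma]
    have hAsw : ∀ x y, (⟨x, y⟩ : (_ : ℂ) × ℂ) ∈ A → (⟨y, x⟩ : (_ : ℂ) × ℂ) ∈ A := by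
      intro x y h
      rw [hA] at h ⊢
      exact ⟨hnb x h.1 h.2, hsymm x h.1 y h.2⟩
    have hAup : (A.filter up).card = (A.filter fun p => ¬ up p).card := by
      have : A.filter (fun p => ¬ up p) = (A.filter up).image sw := by
        ext ⟨x, y⟩
        simp only [Finset.mem_filter, Finset.mem_image, sw]
        constructor
        · rintro ⟨h1, h2⟩
          refine ⟨⟨y, x⟩, ⟨hAsw _ _ h1, ?_⟩, rfl⟩
          have := hneg x ((hA _ _).1 h1).1 y ((hA _ _).1 h1).2
          simp only [up] at h2 ⊢
          omega
        · rintro ⟨⟨x', y'⟩, ⟨h1, h2⟩, h3⟩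
          simp only [Sigma.mk.injEq, heq_eq_eq] at h3
          obtain ⟨rfl, rfl⟩ := h3
          refine ⟨hAsw _ _ h1, ?_⟩
          have := hneg _ ((hA _ _).1 h1).1 _ ((hA _ _).1 h1).2
          simp only [up] at h2 ⊢
          omega
      rw [this, Finset.card_image_of_injective _ hsw]
    have hAcard : (A.filter up).card + (A.filter fun p => ¬ up p).card = ∑ x ∈ C, (nb x).card := by
      rw [Finset.card_filter_add_card_filter_not, Finset.card_sigma]
    -- `Kp` are the bonds that are kept at both ends, `Dr` the half bonds that are cut off at their
    -- first end
    let Kp := (A.filter up).filter fun p => lab p ∧ lab (sw p)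
    let Dr := A.filter fun p => ¬ lab p
    -- a kept bond provides a predecessor for its upper end
    have hKp : Kp.card ≤ (E.filter fun i => ¬ ∀ j, ¬ r j i).card := by
      refine Finset.card_le_card_of_injOn (fun p => (p.1, sector t (p.1 - p.2) % 20)) ?_ ?_
      · rintro ⟨x, y⟩ h
        simp only [Kp, Finset.coe_filter, Finset.mem_filter, hA, Set.mem_ofPred_eq, lab, up, sw] at h
        obtain ⟨⟨⟨hx, hy⟩, h1⟩, h2, h3⟩ := h
        have h4 := hneg x hx y hy
        have hlx := hl x hx
        have hly := hl y (hnb x hx hy)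
        have m1 : (x, sector t (x - y) % 20) ∈ E := (hE _ _).2 ⟨hx, by omega⟩
        have m2 : (y, sector t (x - y) % 20) ∈ E := (hE _ _).2 ⟨hnb x hx hy, by omega⟩
        rw [Finset.mem_coe, Finset.mem_filter]
        refine ⟨m1, fun hno => hno (y, sector t (x - y) % 20) ⟨rfl, m2, m1, hy, ?_⟩⟩
        simp only
        omega
      · rintro ⟨x, y⟩ h ⟨x', y'⟩ h' heq
        simp only [Kp, Finset.coe_filter, Finset.mem_filter, hA, Set.mem_ofPred_eq] at h h'
        obtain ⟨rfl, heq⟩ := Prod.mk.inj heq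
        obtain ⟨⟨⟨hx, hy⟩, -⟩, -⟩ := h
        obtain ⟨⟨⟨-, hy'⟩, -⟩, -⟩ := h'
        have h1 := hneg x hx y hy
        have h2 := hneg x hx y' hy'
        simp only at heq
        rw [hinj x hx y (Finset.mem_union_left _ hy) y' (Finset.mem_union_left _ hy') (by omega)]
    have hDr : (A.filter up).card ≤ Kp.card + Dr.card := by
      have hsubset : A.filter up ⊆ Kp ∪ (Dr.filter up ∪ (Dr.filter fun p => ¬ up p).image sw) := by
        rintro ⟨x, y⟩ h
        obtain ⟨h1, h2⟩ := Finset.mem_filter.1 h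
        by_cases h3 : lab ⟨x, y⟩
        · by_cases h4 : lab ⟨y, x⟩
          · exact Finset.mem_union_left _ (Finset.mem_filter.2 ⟨h, h3, h4⟩)
          · refine Finset.mem_union_right _ (Finset.mem_union_right _ (Finset.mem_image.2
              ⟨⟨y, x⟩, Finset.mem_filter.2 ⟨Finset.mem_filter.2 ⟨hAsw _ _ h1, h4⟩, ?_⟩, rfl⟩))
            have := hneg x ((hA _ _).1 h1).1 y ((hA _ _).1 h1).2
            simp only [up] at h2 ⊢
            omega
        · exact Finset.mem_union_right _ (Finset.mem_union_left _ (Finset.mem_filter.2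
            ⟨Finset.mem_filter.2 ⟨h1, h3⟩, h2⟩))
      calc (A.filter up).card ≤ _ := Finset.card_le_card hsubset
        _ ≤ Kp.card + ((Dr.filter up).card + (Dr.filter fun p => ¬ up p).card) := by
            refine (Finset.card_union_le _ _).trans (Nat.add_le_add_left ?_ _)
            refine (Finset.card_union_le _ _).trans (Nat.add_le_add_left ?_ _)
            exact Finset.card_image_le
        _ = _ := by rw [Finset.card_filter_add_card_filter_not]
    -- each cut is charged to a broken straight angle
    have hDb : Dr.card ≤ broken.card := by
      have hex : ∀ p : (_ : ℂ) × ℂ, ∃ z, p ∈ Dr → (p.2, p.1, z) ∈ broken := by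
        rintro ⟨x, y⟩
        by_cases h : (⟨x, y⟩ : (_ : ℂ) × ℂ) ∈ Dr
        · obtain ⟨h1, h2⟩ := Finset.mem_filter.1 h
          obtain ⟨hx, hy⟩ := (hA _ _).1 h1
          have hy' := Finset.mem_union_left (sub x) hy
          obtain ⟨z, hz, hyz, hb⟩ := (hl x hx).2.2.2.2.2.2.2 y hy' h2
          exact ⟨z, fun _ => hbroken x hx y hy' z hz hyz hb⟩
        · exact ⟨0, fun h' => absurd h' h⟩
      choose z hz using hex
      refine Finset.card_le_card_of_injOn (fun p => (p.2, p.1, z p)) (fun p hp => hz p hp) ?_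
      rintro ⟨x, y⟩ - ⟨x', y'⟩ - h
      simp only [Prod.mk.injEq] at h
      rw [h.1, h.2.1]
    have hI : I.card + (E.filter fun i => ¬ ∀ j, ¬ r j i).card = E.card :=
      Finset.card_filter_add_card_filter_not _
    omega

/-! ### Bond angles and sectors -/

/-- The angles within `δ` of a nonzero multiple of a right angle. -/
def nearRightAngles (δ : ℝ) : Set ℝ :=
  Set.Icc (Real.pi / 2 - δ) (Real.pi / 2 + δ) ∪ Set.Icc (Real.pi - δ) (Real.pi + δ) ∪
    Set.Icc (3 * Real.pi / 2 - δ) (3 * Real.pi / 2 + δ)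

theorem finite_substrate_near (r : ℝ) (x : ℂ) : {z : ℂ | z ∈ substrate ∧ ‖x - z‖ < r}.Finite :=
  (finite_squareLattice_near x r).subset fun _ hz => ⟨hz.1.1, hz.2⟩

open Classical in
/-- The neighbours of `x` in `C`. -/
noncomputable def configNbrs (r : ℝ) (C : Finset ℂ) (x : ℂ) : Finset ℂ :=
  C.filter fun y => y ≠ x ∧ ‖x - y‖ < r

/-- The neighbours of `x` in the substrate. -/
noncomputable def substrateNbrs (r : ℝ) (x : ℂ) : Finset ℂ := (finite_substrate_near r x).toFinset

/-- The triples of `bondTriples` that are centred at a point of the configuration. -/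
noncomputable def centredTriples (r : ℝ) (C : Finset ℂ) : Finset (ℂ × ℂ × ℂ) :=
  C.biUnion fun x => (configNbrs r C x ∪ substrateNbrs r x).offDiag.image fun p => (p.1, x, p.2)

theorem mem_configNbrs {r : ℝ} {C : Finset ℂ} {x y : ℂ} :
    y ∈ configNbrs r C x ↔ y ∈ C ∧ y ≠ x ∧ ‖x - y‖ < r := by
  classical
  simp [configNbrs]

theorem mem_substrateNbrs {r : ℝ} {x z : ℂ} :
    z ∈ substrateNbrs r x ↔ z ∈ substrate ∧ ‖x - z‖ < r := by
  simp [substrateNbrs]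

theorem mem_centredTriples {r : ℝ} {C : Finset ℂ} {y x z : ℂ} :
    (y, x, z) ∈ centredTriples r C ↔ x ∈ C ∧ y ∈ configNbrs r C x ∪ substrateNbrs r x ∧
      z ∈ configNbrs r C x ∪ substrateNbrs r x ∧ y ≠ z := by
  simp only [centredTriples, Finset.mem_biUnion, Finset.mem_image, Finset.mem_offDiag, Prod.mk.injEq,
    Prod.exists]
  constructor
  · rintro ⟨x', hx', y', z', ⟨h1, h2, h3⟩, rfl, rfl, rfl⟩
    exact ⟨hx', h1, h2, h3⟩
  · rintro ⟨h0, h1, h2, h3⟩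
    exact ⟨x, h0, y, z, ⟨h1, h2, h3⟩, rfl, rfl, rfl⟩

theorem ne_of_mem_substrate {C : Finset ℂ} (hC : ∀ x ∈ C, 0 < x.im) {x z : ℂ} (hx : x ∈ C)
    (hz : z ∈ substrate) : x ≠ z := by
  rintro rfl
  exact absurd (hC _ hx) (not_lt.2 hz.2)

theorem mem_nbrs_iff {r : ℝ} {C : Finset ℂ} (hC : ∀ x ∈ C, 0 < x.im) {x y : ℂ} (hx : x ∈ C) :
    y ∈ configNbrs r C x ∪ substrateNbrs r x ↔
      y ∈ (C : Set ℂ) ∪ substrate ∧ y ≠ x ∧ ‖x - y‖ < r := by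
  rw [Finset.mem_union, mem_configNbrs, mem_substrateNbrs]
  constructor
  · rintro (⟨h1, h2, h3⟩ | ⟨h1, h2⟩)
    · exact ⟨Or.inl h1, h2, h3⟩
    · exact ⟨Or.inr h1, (ne_of_mem_substrate hC hx h1).symm, h2⟩
  · rintro ⟨h1 | h1, h2, h3⟩
    · exact Or.inl ⟨h1, h2, h3⟩
    · exact Or.inr ⟨h1, h3⟩

theorem centredTriples_subset {r : ℝ} {C : Finset ℂ} (hC : ∀ x ∈ C, 0 < x.im) :
    (centredTriples r C : Set (ℂ × ℂ × ℂ)) ⊆ bondTriples r C := by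
  rintro ⟨y, x, z⟩ h
  obtain ⟨hx, hy, hz, hyz⟩ := mem_centredTriples.1 h
  rw [mem_nbrs_iff hC hx] at hy hz
  exact ⟨hy.1, Or.inl hx, hz.1, hy.2.1, hz.2.1.symm, hyz, by simpa [norm_sub_rev] using hy.2.2,
    hz.2.2⟩

theorem exists_bondAngle_eq {y x z : ℂ} (hy : y ≠ x) (hz : z ≠ x) :
    ∃ n : ℤ, bondAngle y x z = (y - x).arg - (z - x).arg + 2 * Real.pi * n := by
  obtain ⟨n, hn⟩ := exists_arg_div (y - x) (z - x) (sub_ne_zero.2 hy) (sub_ne_zero.2 hz)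
  refine ⟨n - toIcoDiv Real.two_pi_pos 0 ((y - x) / (z - x)).arg, ?_⟩
  unfold bondAngle
  have := self_sub_toIcoDiv_zsmul Real.two_pi_pos 0 ((y - x) / (z - x)).arg
  rw [← this, hn, zsmul_eq_mul]
  push_cast
  ring

theorem bondAngle_mem_Ico (y x z : ℂ) : 0 ≤ bondAngle y x z ∧ bondAngle y x z < 2 * Real.pi := by
  have := toIcoMod_mem_Ico Real.two_pi_pos 0 ((y - x) / (z - x)).arg
  rw [zero_add] at this
  exact this

theorem floor_sub_floor_of_eq (t p q : ℝ) (m : ℤ) (δ : ℝ) (hδ : |δ| ≤ 1 / 2) (h : p = q + m + δ) :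
    m - 1 ≤ ⌊p - t⌋ - ⌊q - t⌋ ∧ ⌊p - t⌋ - ⌊q - t⌋ ≤ m + 1 := by
  obtain ⟨h1, h2⟩ := abs_le.1 hδ
  have h3 : ⌊q - t⌋ + (m - 1) ≤ ⌊p - t⌋ := by
    rw [← Int.floor_add_intCast]
    apply Int.floor_mono
    push_cast
    linarith
  have h4 : ⌊p - t⌋ ≤ ⌊q - t⌋ + (m + 1) := by
    rw [← Int.floor_add_intCast]
    apply Int.floor_mono
    push_cast
    linarith
  omega

theorem ten_div_pi_mul_le {δ : ℝ} (hδ : δ ≤ 1 / 10) {u : ℝ} (hu : |u| ≤ δ) :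
    |10 / Real.pi * u| ≤ 1 / 2 := by
  have hpi := Real.pi_gt_three
  rw [abs_mul, abs_of_pos (by positivity), div_mul_eq_mul_div, div_le_iff₀ (by positivity)]
  nlinarith

/-- An angle close to a right angle `k π / 2`, in terms of sectors. -/
theorem sector_sub_sector {δ t : ℝ} (hδ : δ ≤ 1 / 10) {y x z : ℂ} (hy : y ≠ x) (hz : z ≠ x) (k : ℤ)
    (h : |bondAngle y x z - k * (Real.pi / 2)| ≤ δ) :
    ∃ n : ℤ, 5 * k + 20 * n - 1 ≤ sector t (y - x) - sector t (z - x) ∧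
      sector t (y - x) - sector t (z - x) ≤ 5 * k + 20 * n + 1 := by
  obtain ⟨n, hn⟩ := exists_bondAngle_eq hy hz
  have hpi := Real.pi_ne_zero
  have := floor_sub_floor_of_eq t ((y - x).arg * (10 / Real.pi)) ((z - x).arg * (10 / Real.pi))
    (5 * k + 20 * (-n)) (10 / Real.pi * (bondAngle y x z - k * (Real.pi / 2)))
    (ten_div_pi_mul_le hδ h) (by rw [hn]; push_cast; field_simp; ring)
  exact ⟨-n, this⟩

theorem exists_of_mem_nearRightAngles {δ θ : ℝ} (h : θ ∈ nearRightAngles δ) :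
    ∃ k : ℤ, 1 ≤ k ∧ k ≤ 3 ∧ |θ - k * (Real.pi / 2)| ≤ δ ∧ (k = 2 → |θ - Real.pi| ≤ δ) := by
  rcases h with (⟨h1, h2⟩ | ⟨h1, h2⟩) | ⟨h1, h2⟩
  · refine ⟨1, by norm_num, by norm_num, abs_le.2 ⟨?_, ?_⟩, by norm_num⟩ <;> push_cast <;> linarith
  · refine ⟨2, by norm_num, by norm_num, abs_le.2 ⟨?_, ?_⟩, fun _ => abs_le.2 ⟨?_, ?_⟩⟩ <;>
      push_cast <;> linarith
  · refine ⟨3, by norm_num, by norm_num, abs_le.2 ⟨?_, ?_⟩, by norm_num⟩ <;> push_cast <;> linarith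

theorem isRightTurn_of_mem {δ t : ℝ} (hδ : δ ≤ 1 / 10) {y x z : ℂ} (hy : y ≠ x) (hz : z ≠ x)
    (h : bondAngle y x z ∈ nearRightAngles δ) :
    IsRightTurn (sector t (y - x) - sector t (z - x)) := by
  obtain ⟨k, h1, h3, hk, -⟩ := exists_of_mem_nearRightAngles h
  obtain ⟨n, hn⟩ := sector_sub_sector (t := t) hδ hy hz k hk
  unfold IsRightTurn
  omega

/-- A straight angle is broken only if the grid of sectors separates its legs. -/
theorem floor_ne_of_isBroken {δ t : ℝ} (hδ : δ ≤ 1 / 10) {y x z : ℂ} (hy : y ≠ x) (hz : z ≠ x)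
    (h : bondAngle y x z ∈ nearRightAngles δ)
    (hb : IsBroken (sector t (y - x) - sector t (z - x))) :
    |bondAngle y x z - Real.pi| ≤ δ ∧
      ⌊(y - x).arg * (10 / Real.pi) - t⌋ ≠
        ⌊(y - x).arg * (10 / Real.pi) - 10 / Real.pi * (bondAngle y x z - Real.pi) - t⌋ := by
  obtain ⟨k, h1, h3, hk, hk2⟩ := exists_of_mem_nearRightAngles h
  obtain ⟨n, hn⟩ := sector_sub_sector (t := t) hδ hy hz k hk
  refine ⟨hk2 (by unfold IsBroken at hb; omega), fun heq => ?_⟩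
  obtain ⟨m, hm⟩ := exists_bondAngle_eq hy hz
  have hpi := Real.pi_ne_zero
  have e : (y - x).arg * (10 / Real.pi) - 10 / Real.pi * (bondAngle y x z - Real.pi) - t
      = (z - x).arg * (10 / Real.pi) - t + ((10 - 20 * m : ℤ) : ℝ) := by
    rw [hm]; push_cast; field_simp; ring
  rw [e, Int.floor_add_intCast] at heq
  unfold IsBroken sector at hb
  omega

theorem add_mem_substrate {z : ℂ} (hz : z ∈ substrate) (a b : ℤ) (hb : b ≤ 0) :
    z + ⟨(a : ℝ), (b : ℝ)⟩ ∈ substrate := by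
  obtain ⟨⟨p, q, rfl⟩, h⟩ := hz
  refine ⟨⟨p + a, q + b, ?_⟩, ?_⟩
  · apply Complex.ext <;> simp
  · have : (b : ℝ) ≤ 0 := by exact_mod_cast hb
    simp only [Set.mem_ofPred_eq] at h
    simp only [Set.mem_ofPred_eq, Complex.add_im]
    linarith

theorem im_eq_zero_of_near {r : ℝ} (hr : r < √2) {x z : ℂ} (hx : 0 < x.im)
    (hsep : ∀ z ∈ substrate, 9 / 10 < ‖x - z‖) (hz : z ∈ substrate) (hxz : ‖x - z‖ < r) :
    z.im = 0 := by
  obtain ⟨⟨p, q, rfl⟩, h⟩ := hz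
  simp only [Set.mem_ofPred_eq] at h
  by_contra hq
  simp only at hq
  have hq0 : q ≤ -1 := by
    have h1 : q ≤ 0 := by exact_mod_cast h
    have h2 : q ≠ 0 := by exact_mod_cast hq
    omega
  have hq1 : (q : ℝ) ≤ -1 := by exact_mod_cast hq0
  have hs2 : √2 < 1.415 := by
    rw [Real.sqrt_lt' (by norm_num)]; norm_num
  have him := (Complex.abs_im_le_norm _).trans_lt (hxz.trans (hr.trans hs2))
  rw [Complex.sub_im, abs_lt] at him
  simp only at him
  have h1 := hsep ⟨(round x.re : ℤ), (0 : ℤ)⟩ ⟨⟨round x.re, 0, rfl⟩, by simp⟩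
  have h2 := abs_le.1 (abs_sub_round x.re)
  have h3 : ‖x - ⟨(round x.re : ℤ), (0 : ℤ)⟩‖ ^ 2 = (x.re - round x.re) ^ 2 + x.im ^ 2 := by
    rw [Complex.sq_norm, Complex.normSq_apply]
    simp
    ring
  have h4 : (x.re - round x.re) ^ 2 ≤ (1 / 2) ^ 2 := sq_le_sq' h2.1 h2.2
  have h5 : x.im ^ 2 ≤ (415 / 1000) ^ 2 := pow_le_pow_left₀ hx.le (by linarith) 2
  have h6 : (9 / 10 : ℝ) ^ 2 < ‖x - ⟨(round x.re : ℤ), (0 : ℤ)⟩‖ ^ 2 :=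
    pow_lt_pow_left₀ h1 (by norm_num) two_ne_zero
  rw [h3] at h6
  norm_num at h4 h5 h6
  linarith

/-- A point bonded to the substrate sits almost vertically above a point of the top layer of the
substrate, because the latter has three neighbours in the substrate. -/
theorem arg_sub_substrate {r δ : ℝ} (hδ : δ ≤ 1 / 10) (hr1 : 1 < r) {C : Finset ℂ}
    (hC : ∀ x ∈ C, 0 < x.im)
    (hgood : ∀ τ ∈ bondTriples r C, bondAngle τ.1 τ.2.1 τ.2.2 ∈ nearRightAngles δ) {x z : ℂ}
    (hx : x ∈ C) (hz : z ∈ substrate) (hxz : ‖x - z‖ < r) :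
    |(x - z).arg - Real.pi / 2| ≤ δ := by
  have hpi := Real.pi_gt_three
  have hxim : 0 < (x - z).im := by
    have h1 := hC x hx
    have h2 : z.im ≤ 0 := hz.2
    rw [Complex.sub_im]
    linarith
  have hα0 : 0 < (x - z).arg := by
    refine lt_of_le_of_ne (Complex.arg_nonneg_iff.2 hxim.le) fun h => ?_
    have := (Complex.arg_eq_zero_iff.1 h.symm).2
    linarith
  have hαpi : (x - z).arg < Real.pi := by
    refine lt_of_le_of_ne (Complex.arg_le_pi _) fun h => ?_
    have := (Complex.arg_eq_pi_iff.1 h).2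
    linarith
  have hxz' := ne_of_mem_substrate hC hx hz
  have key : ∀ a b : ℤ, b ≤ 0 → ‖(⟨(a : ℝ), (b : ℝ)⟩ : ℂ)‖ = 1 → ∃ n : ℤ, ∃ θ : ℝ,
      θ = (x - z).arg - (⟨(a : ℝ), (b : ℝ)⟩ : ℂ).arg + 2 * Real.pi * n ∧
      0 ≤ θ ∧ θ < 2 * Real.pi ∧ θ ∈ nearRightAngles δ := by
    intro a b hb h1
    have hzw := add_mem_substrate hz a b hb
    have hw0 : (⟨(a : ℝ), (b : ℝ)⟩ : ℂ) ≠ 0 := by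
      rintro h
      rw [h] at h1
      simp at h1
    generalize (⟨(a : ℝ), (b : ℝ)⟩ : ℂ) = w at h1 hzw hw0 ⊢
    obtain ⟨n, hn⟩ := exists_bondAngle_eq (x := z) hxz' (z := z + w) (by simpa using hw0)
    rw [add_sub_cancel_left] at hn
    have hτ : (x, z, z + w) ∈ bondTriples r C := ⟨Or.inl hx, Or.inr hz, Or.inr hzw, hxz',
      by simpa using hw0, ne_of_mem_substrate hC hx hzw, hxz, by simpa [h1] using hr1⟩
    have hθ := hgood _ hτ
    dsimp only at hθ
    exact ⟨n, _, hn, (bondAngle_mem_Ico _ _ _).1, (bondAngle_mem_Ico _ _ _).2, hθ⟩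
  have hint : ∀ n : ℤ, ((n : ℝ) < 1 → n ≤ 0) ∧ (-1 < (n : ℝ) → 0 ≤ n) ∧ (0 < (n : ℝ) → 1 ≤ n) ∧
      ((n : ℝ) < 2 → n ≤ 1) := by
    intro n
    refine ⟨fun h => ?_, fun h => ?_, fun h => ?_, fun h => ?_⟩
    · have : n < 1 := by exact_mod_cast h
      omega
    · have : -1 < n := by exact_mod_cast h
      omega
    · have : 0 < n := by exact_mod_cast h
      omega
    · have : n < 2 := by exact_mod_cast h
      omega
  have hdown : (⟨((0 : ℤ) : ℝ), ((-1 : ℤ) : ℝ)⟩ : ℂ) = -Complex.I := by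
    apply Complex.ext <;> simp
  have hright : (⟨((1 : ℤ) : ℝ), ((0 : ℤ) : ℝ)⟩ : ℂ) = 1 := by
    apply Complex.ext <;> simp
  have hleft : (⟨((-1 : ℤ) : ℝ), ((0 : ℤ) : ℝ)⟩ : ℂ) = -1 := by
    apply Complex.ext <;> simp
  have k1 := key 0 (-1) (by norm_num) (by rw [hdown]; simp)
  have k2 := key 1 0 (by norm_num) (by rw [hright]; simp)
  have k3 := key (-1) 0 (by norm_num) (by rw [hleft]; simp)
  rw [hdown, Complex.arg_neg_I] at k1
  rw [hright, Complex.arg_one] at k2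
  rw [hleft, Complex.arg_neg_one] at k3
  obtain ⟨n, θ, hθ, h0, h2, hm⟩ := k1
  obtain ⟨n', θ', hθ', h0', h2', hm'⟩ := k2
  obtain ⟨n'', θ'', hθ'', h0'', h2'', hm''⟩ := k3
  have hn : n = 0 := by
    have a1 := (hint n).1 (by nlinarith)
    have a2 := (hint n).2.1 (by nlinarith)
    omega
  have hn' : n' = 0 := by
    have a1 := (hint n').1 (by nlinarith)
    have a2 := (hint n').2.1 (by nlinarith)
    omega
  have hn'' : n'' = 1 := by
    have a1 := (hint n'').2.2.1 (by nlinarith)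
    have a2 := (hint n'').2.2.2 (by nlinarith)
    omega
  subst hn hn' hn''
  push_cast at hθ hθ' hθ''
  have hlow : Real.pi / 2 - δ ≤ θ' := by
    rcases hm' with (⟨h, -⟩ | ⟨h, -⟩) | ⟨h, -⟩ <;> linarith
  have hupp : θ'' ≤ 3 * Real.pi / 2 + δ := by
    rcases hm'' with (⟨-, h⟩ | ⟨-, h⟩) | ⟨-, h⟩ <;> linarith
  rw [abs_le]
  rcases hm with (⟨h3, h4⟩ | ⟨h3, h4⟩) | ⟨h3, h4⟩ <;> constructor <;> linarith

/-- The stratification of a configuration with almost right bond angles. The sectors are rotated in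
such a way that the number of broken straight angles is at most the sum of their deviations from
`π`, measured in units of the opening of a sector. -/
theorem exists_strata_of_near {r δ : ℝ} (hδ : δ ≤ 1 / 10) (hr1 : 1 < r)
    {C : Finset ℂ} (hC : ∀ x ∈ C, 0 < x.im)
    (hgood : ∀ τ ∈ bondTriples r C, bondAngle τ.1 τ.2.1 τ.2.2 ∈ nearRightAngles δ)
    (w : ℝ → ℝ) (hw0 : ∀ θ, 0 ≤ θ → θ ≤ 2 * Real.pi → 0 ≤ w θ)
    (hw : ∀ θ, |θ - Real.pi| ≤ δ → 10 / Real.pi * |θ - Real.pi| ≤ w θ) :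
    ∃ a b : ℕ, C.card ≤ a * b ∧ ∑ x ∈ C, (substrateNbrs r x).card ≤ a ∧
      ∑ x ∈ C, (substrateNbrs r x).card ≤ C.card ∧
      (a + b : ℝ) + 1 / 2 * ∑ x ∈ C, ((configNbrs r C x).card : ℝ) ≤
        2 * C.card + ∑ τ ∈ centredTriples r C, w (bondAngle τ.1 τ.2.1 τ.2.2) := by
  classical
  have hpi := Real.pi_pos
  obtain ⟨t, ht0, ht1, ht⟩ := exists_translate_separating_le (centredTriples r C)
    (fun τ => (τ.1 - τ.2.1).arg * (10 / Real.pi))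
    (fun τ => (τ.1 - τ.2.1).arg * (10 / Real.pi) -
      if |bondAngle τ.1 τ.2.1 τ.2.2 - Real.pi| ≤ δ then
        10 / Real.pi * (bondAngle τ.1 τ.2.1 τ.2.2 - Real.pi) else 0)
  set broken := (centredTriples r C).filter fun τ =>
    ⌊(τ.1 - τ.2.1).arg * (10 / Real.pi) - t⌋ ≠ ⌊((τ.1 - τ.2.1).arg * (10 / Real.pi) -
      if |bondAngle τ.1 τ.2.1 τ.2.2 - Real.pi| ≤ δ then
        10 / Real.pi * (bondAngle τ.1 τ.2.1 τ.2.2 - Real.pi) else 0) - t⌋ with hbr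
  have hmem : ∀ x ∈ C, ∀ y ∈ configNbrs r C x ∪ substrateNbrs r x,
      ∀ z ∈ configNbrs r C x ∪ substrateNbrs r x, y ≠ z →
      y ≠ x ∧ z ≠ x ∧ (y, x, z) ∈ centredTriples r C ∧ bondAngle y x z ∈ nearRightAngles δ := by
    intro x hx y hy z hz hyz
    have h := mem_centredTriples.2 ⟨hx, hy, hz, hyz⟩
    have hθ := hgood _ (centredTriples_subset hC h)
    dsimp only at hθ
    exact ⟨((mem_nbrs_iff hC hx).1 hy).2.1, ((mem_nbrs_iff hC hx).1 hz).2.1, h, hθ⟩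
  obtain ⟨a, b, h1, h2, h3, h4⟩ := exists_strata t C (configNbrs r C) (substrateNbrs r)
    (fun x _ y hy => (mem_configNbrs.1 hy).1)
    (fun x _ h => (mem_configNbrs.1 h).2.1 rfl)
    (fun x hx y hy => by
      rw [mem_configNbrs] at hy ⊢
      exact ⟨hx, hy.2.1.symm, by rw [norm_sub_rev]; exact hy.2.2⟩)
    (fun x _ => Finset.disjoint_left.2 fun z hz hzC =>
      ne_of_mem_substrate hC hzC (mem_substrateNbrs.1 hz).1 rfl)
    (fun x hx y hy z hz hyz => by
      obtain ⟨g1, g2, -, g4⟩ := hmem x hx y hy z hz hyz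
      exact isRightTurn_of_mem hδ g1 g2 g4)
    (fun x hx z hz => by
      obtain ⟨hz1, hz2⟩ := mem_substrateNbrs.1 hz
      have harg := arg_sub_substrate hδ hr1 hC hgood hx hz1 hz2
      have him : 0 < (x - z).im := by
        have h1 := hC x hx
        have h2 : z.im ≤ 0 := hz1.2
        rw [Complex.sub_im]
        linarith
      have hneg := Complex.arg_neg_eq_arg_sub_pi_of_im_pos him
      rw [neg_sub] at hneg
      have h5 := abs_le.1 (ten_div_pi_mul_le hδ harg)
      have h6 : (z - x).arg * (10 / Real.pi)
          = -5 + 10 / Real.pi * ((x - z).arg - Real.pi / 2) := by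
        rw [hneg]; field_simp; ring
      have h7 : -7 ≤ sector t (z - x) := by
        unfold sector
        rw [Int.le_floor]
        push_cast
        linarith
      have h8 : sector t (z - x) ≤ -5 := by
        have : sector t (z - x) < -4 := by
          unfold sector
          rw [Int.floor_lt]
          push_cast
          linarith
        omega
      omega)
    broken
    (fun x hx y hy z hz hyz hb => by
      obtain ⟨g1, g2, g3, g4⟩ := hmem x hx y hy z hz hyz
      obtain ⟨g5, g6⟩ := floor_ne_of_isBroken hδ g1 g2 g4 hb
      rw [hbr, Finset.mem_filter]
      refine ⟨g3, ?_⟩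
      simp only [g5, if_true]
      exact g6)
  refine ⟨a, b, h1, h2, h3, ?_⟩
  have h5 : (broken.card : ℝ) ≤ ∑ τ ∈ centredTriples r C, w (bondAngle τ.1 τ.2.1 τ.2.2) := by
    refine ht.trans (Finset.sum_le_sum fun τ _ => ?_)
    rw [sub_sub_cancel]
    split_ifs with h
    · rw [abs_mul, abs_of_pos (by positivity)]
      exact hw _ h
    · rw [abs_zero]
      exact hw0 _ (bondAngle_mem_Ico _ _ _).1 (bondAngle_mem_Ico _ _ _).2.le
  have h6 : 2 * ((a : ℝ) + b) + ∑ x ∈ C, ((configNbrs r C x).card : ℝ)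
      ≤ 4 * C.card + 2 * broken.card := by exact_mod_cast h4
  linarith

/-! ### Truncated potentials and the removal of points -/

/-- The assumptions on the two-body potential for a real-valued function. -/
structure IsRealTwoBodyPotential (ε r₀ : ℝ) (u : ℝ → ℝ) : Prop where
  at_one : u 1 = -1
  gt_of_ne_one : ∀ s : ℝ, 0 ≤ s → s ≠ 1 → -1 < u s
  one_lt_range : 1 < r₀
  range_lt : r₀ < √2
  eq_zero : ∀ s : ℝ, r₀ ≤ s → u s = 0
  repulsive : ∀ s : ℝ, 0 ≤ s → s ≤ 1 - ε → ε⁻¹ < u s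

theorem IsRealTwoBodyPotential.neg_one_le {ε r₀ : ℝ} {u : ℝ → ℝ}
    (hu : IsRealTwoBodyPotential ε r₀ u) {s : ℝ} (hs : 0 ≤ s) : -1 ≤ u s := by
  by_cases h : s = 1
  · rw [h, hu.at_one]
  · exact (hu.gt_of_ne_one s hs h).le

open Classical in
/-- The two-body interaction of two points of the configuration, set to be `0` on the diagonal. -/
noncomputable def pairEnergy (u : ℝ → ℝ) (x y : ℂ) : ℝ := if x = y then 0 else u ‖x - y‖

/-- The energy for a real-valued two-body potential; the substrate sum only extends over the
neighbours in the substrate. -/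
noncomputable def realEnergy (β r₀ : ℝ) (u v₃ : ℝ → ℝ) (C : Finset ℂ) : ℝ :=
  1 / 2 * ∑ x ∈ C, ∑ y ∈ C, pairEnergy u x y
  + β * ∑ x ∈ C, ∑ z ∈ substrateNbrs r₀ x, u ‖x - z‖
  + 1 / 2 * ∑ᶠ t ∈ bondTriples r₀ C, v₃ (bondAngle t.1 t.2.1 t.2.2)

/-- Truncating the two-body potential from above keeps all assumptions. -/
theorem exists_truncation {ε r₀ : ℝ} {v₂ : ℝ → EReal} (hε : 0 < ε)
    (h : IsTwoBodyPotential ε r₀ v₂) :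
    ∃ u : ℝ → ℝ, IsRealTwoBodyPotential ε r₀ u ∧ ∀ s, 0 ≤ s → (u s : EReal) ≤ v₂ s := by
  have hinv : 0 < ε⁻¹ := inv_pos.2 hε
  have hge : ∀ s, 0 ≤ s → -1 ≤ v₂ s := by
    intro s hs
    by_cases h1 : s = 1
    · rw [h1, h.at_one]
    · exact (h.gt_of_ne_one s hs h1).le
  have hcoe : ∀ s, 0 ≤ s → (((min (v₂ s) ((ε⁻¹ + 1 : ℝ) : EReal)).toReal : ℝ) : EReal)
      = min (v₂ s) ((ε⁻¹ + 1 : ℝ) : EReal) := by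
    intro s hs
    refine EReal.coe_toReal ?_ ?_
    · exact ((min_le_right _ _).trans_lt (EReal.coe_lt_top _)).ne
    · refine (lt_min ((EReal.bot_lt_coe (-1)).trans_le ?_) (EReal.bot_lt_coe _)).ne'
      rw [EReal.coe_neg, EReal.coe_one]
      exact hge s hs
  refine ⟨fun s => (min (v₂ s) ((ε⁻¹ + 1 : ℝ) : EReal)).toReal, ?_, fun s hs => ?_⟩
  · have h1 : ∀ s, 0 ≤ s → ∀ c : ℝ, c < ε⁻¹ + 1 → (c : EReal) < v₂ s →
        c < (min (v₂ s) ((ε⁻¹ + 1 : ℝ) : EReal)).toReal := by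
      intro s hs c hc hcv
      rw [← EReal.coe_lt_coe_iff, hcoe s hs]
      exact lt_min hcv (EReal.coe_lt_coe_iff.2 hc)
    have h2 : ∀ s, 0 ≤ s → ∀ c : ℝ, c ≤ ε⁻¹ + 1 → v₂ s = c →
        (min (v₂ s) ((ε⁻¹ + 1 : ℝ) : EReal)).toReal = c := by
      intro s hs c hc hcv
      rw [← EReal.coe_eq_coe_iff, hcoe s hs, hcv, min_eq_left (EReal.coe_le_coe_iff.2 hc)]
    refine ⟨h2 1 zero_le_one (-1) (by linarith) (by rw [h.at_one]; rfl), fun s hs hs1 => ?_,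
      h.one_lt_range, h.range_lt, fun s hs => ?_, fun s hs hs1 => ?_⟩
    · exact h1 s hs (-1) (by linarith) (by
        rw [EReal.coe_neg, EReal.coe_one]; exact h.gt_of_ne_one s hs hs1)
    · exact h2 s (by linarith [h.one_lt_range]) 0 (by linarith) (by rw [h.eq_zero s hs]; rfl)
    · exact h1 s hs _ (by linarith) (h.repulsive s hs hs1)
  · rw [hcoe s hs]
    exact min_le_left _ _

theorem realEnergy_le_energy {β ε r₀ : ℝ} {v₂ : ℝ → EReal} {u v₃ : ℝ → ℝ} (hβ : 0 < β)
    (h : IsTwoBodyPotential ε r₀ v₂) (hu : ∀ s, 0 ≤ s → (u s : EReal) ≤ v₂ s) (C : Finset ℂ) :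
    (realEnergy β r₀ u v₃ C : EReal) ≤ energy β r₀ v₂ v₃ C := by
  classical
  have h1 : ∑ x ∈ C, ∑ y ∈ C, pairEnergy u x y = ∑ p ∈ C.offDiag, u ‖p.1 - p.2‖ := by
    have : C.offDiag = (C ×ˢ C).filter fun p => p.1 ≠ p.2 := by
      ext p
      simp [and_assoc]
    rw [← Finset.sum_product', this, Finset.sum_filter]
    refine Finset.sum_congr rfl fun p _ => ?_
    unfold pairEnergy
    by_cases hp : p.1 = p.2 <;> simp [hp]
  have h2 : ∀ x, ∑ᶠ z ∈ substrate, v₂ ‖x - z‖ = ∑ z ∈ substrateNbrs r₀ x, v₂ ‖x - z‖ := by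
    intro x
    apply finsum_mem_eq_sum_of_inter_support_eq
    ext z
    simp only [Set.mem_inter_iff, Function.mem_support, Finset.mem_coe, mem_substrateNbrs]
    constructor
    · rintro ⟨hz, hv⟩
      exact ⟨⟨hz, not_le.1 fun hle => hv (h.eq_zero _ hle)⟩, hv⟩
    · rintro ⟨hz, hv⟩
      exact ⟨hz.1, hv⟩
  have hsum : ∀ {ι : Type} (s : Finset ι) (f : ι → ℝ), ((∑ i ∈ s, f i : ℝ) : EReal)
      = ∑ i ∈ s, (f i : EReal) := fun s f => by
    induction s using Finset.induction_on with
    | empty => simp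
    | insert a s ha ih => rw [Finset.sum_insert ha, Finset.sum_insert ha, EReal.coe_add, ih]
  unfold realEnergy energy
  rw [h1, EReal.coe_add, EReal.coe_add, EReal.coe_mul, EReal.coe_mul, hsum, hsum]
  refine add_le_add (add_le_add ?_ ?_) le_rfl
  · refine mul_le_mul_of_nonneg_left (Finset.sum_le_sum fun p _ => hu _ (norm_nonneg _)) ?_
    exact_mod_cast (by norm_num : (0 : ℝ) ≤ 1 / 2)
  · refine mul_le_mul_of_nonneg_left (Finset.sum_le_sum fun x _ => ?_) ?_
    · rw [h2, hsum]
      exact Finset.sum_le_sum fun z _ => hu _ (norm_nonneg _)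
    · exact_mod_cast hβ.le

theorem IsThreeBodyPotential.nonneg {β ε : ℝ} {v₃ : ℝ → ℝ} (h : IsThreeBodyPotential β ε v₃) {θ : ℝ}
    (h0 : 0 ≤ θ) (h1 : θ ≤ 2 * Real.pi) : 0 ≤ v₃ θ := by
  by_cases e1 : θ = Real.pi / 2
  · rw [e1, h.zero_half_pi]
  by_cases e2 : θ = Real.pi
  · rw [e2, h.zero_pi]
  by_cases e3 : θ = 3 * Real.pi / 2
  · rw [e3, h.zero_three_half_pi]
  exact (h.pos θ ⟨h0, h1⟩ e1 e2 e3).le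

theorem exists_finset_sum_eq_finsum {β ε r₀ : ℝ} {v₂ : ℝ → EReal} {v₃ : ℝ → ℝ}
    (h₂ : IsTwoBodyPotential ε r₀ v₂) (h₃ : IsThreeBodyPotential β ε v₃) (C : Finset ℂ) :
    ∃ F : Finset (ℂ × ℂ × ℂ), (F : Set (ℂ × ℂ × ℂ)) ⊆ bondTriples r₀ C ∧
      ∑ᶠ t ∈ bondTriples r₀ C, v₃ (bondAngle t.1 t.2.1 t.2.2)
        = ∑ t ∈ F, v₃ (bondAngle t.1 t.2.1 t.2.2) ∧
      ∀ t ∈ bondTriples r₀ C, t ∉ F → v₃ (bondAngle t.1 t.2.1 t.2.2) = 0 := by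
  refine ⟨(finite_triple_support h₂ h₃ C).toFinset, ?_, ?_, ?_⟩
  · intro t ht
    rw [Set.Finite.coe_toFinset] at ht
    exact ht.1
  · apply finsum_mem_eq_sum_of_inter_support_eq
    ext t
    simp only [Set.mem_inter_iff, Function.mem_support, Set.Finite.coe_toFinset]
    constructor
    · rintro ⟨h1, h2⟩
      exact ⟨⟨h1, h2⟩, h2⟩
    · rintro ⟨h1, h2⟩
      exact ⟨h1.1, h2⟩
  · intro t ht htF
    by_contra hne
    exact htF ((Set.Finite.mem_toFinset _).2 ⟨ht, hne⟩)

theorem sum_le_finsum_bondTriples {β ε r₀ : ℝ} {v₂ : ℝ → EReal} {v₃ : ℝ → ℝ}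
    (h₂ : IsTwoBodyPotential ε r₀ v₂) (h₃ : IsThreeBodyPotential β ε v₃) (C : Finset ℂ)
    (T : Finset (ℂ × ℂ × ℂ)) (hT : (T : Set (ℂ × ℂ × ℂ)) ⊆ bondTriples r₀ C) :
    ∑ t ∈ T, v₃ (bondAngle t.1 t.2.1 t.2.2)
      ≤ ∑ᶠ t ∈ bondTriples r₀ C, v₃ (bondAngle t.1 t.2.1 t.2.2) := by
  classical
  obtain ⟨F, hF, hsum, hzero⟩ := exists_finset_sum_eq_finsum h₂ h₃ C
  rw [hsum]
  calc ∑ t ∈ T, v₃ (bondAngle t.1 t.2.1 t.2.2)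
      ≤ ∑ t ∈ F ∪ T, v₃ (bondAngle t.1 t.2.1 t.2.2) :=
        Finset.sum_le_sum_of_subset_of_nonneg Finset.subset_union_right fun t _ _ =>
          h₃.nonneg (bondAngle_mem_Ico _ _ _).1 (bondAngle_mem_Ico _ _ _).2.le
    _ = ∑ t ∈ F, v₃ (bondAngle t.1 t.2.1 t.2.2) := by
        symm
        refine Finset.sum_subset Finset.subset_union_left fun t ht htF => hzero t (hT ?_) htF
        exact (Finset.mem_union.1 ht).resolve_left htF

theorem bondTriples_mono (r : ℝ) {C D : Finset ℂ} (h : D ⊆ C) : bondTriples r D ⊆ bondTriples r C := by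
  have hm : ∀ w, w ∈ (D : Set ℂ) ∪ substrate → w ∈ (C : Set ℂ) ∪ substrate := by
    rintro w (hw | hw)
    · exact Or.inl (h hw)
    · exact Or.inr hw
  rintro t ⟨h1, h2, h3, h4⟩
  exact ⟨hm _ h1, hm _ h2, hm _ h3, h4⟩

/-- The energy released by the removal of a point `p`. -/
theorem realEnergy_erase_add_le {β ε r₀ : ℝ} {v₂ : ℝ → EReal} {u v₃ : ℝ → ℝ}
    (h₂ : IsTwoBodyPotential ε r₀ v₂) (h₃ : IsThreeBodyPotential β ε v₃) {C : Finset ℂ} {p : ℂ}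
    (hp : p ∈ C) (T : Finset (ℂ × ℂ × ℂ)) (hT : (T : Set (ℂ × ℂ × ℂ)) ⊆ bondTriples r₀ C)
    (hTp : ∀ t ∈ T, t ∉ bondTriples r₀ (C.erase p)) :
    realEnergy β r₀ u v₃ (C.erase p) + (∑ y ∈ C.erase p, u ‖p - y‖
      + β * ∑ z ∈ substrateNbrs r₀ p, u ‖p - z‖
      + 1 / 2 * ∑ t ∈ T, v₃ (bondAngle t.1 t.2.1 t.2.2)) ≤ realEnergy β r₀ u v₃ C := by
  classical
  obtain ⟨D, hpD, rfl⟩ : ∃ D, p ∉ D ∧ insert p D = C :=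
    ⟨C.erase p, Finset.notMem_erase p C, Finset.insert_erase hp⟩
  rw [Finset.erase_insert hpD] at hTp ⊢
  obtain ⟨F, hF, hsum, -⟩ := exists_finset_sum_eq_finsum h₂ h₃ D
  have h1 : ∑ t ∈ F, v₃ (bondAngle t.1 t.2.1 t.2.2) + ∑ t ∈ T, v₃ (bondAngle t.1 t.2.1 t.2.2)
      ≤ ∑ᶠ t ∈ bondTriples r₀ (insert p D), v₃ (bondAngle t.1 t.2.1 t.2.2) := by
    rw [← Finset.sum_union (Finset.disjoint_left.2 fun t ht ht' => hTp t ht' (hF ht))]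
    refine sum_le_finsum_bondTriples h₂ h₃ _ _ ?_
    rw [Finset.coe_union]
    exact Set.union_subset (hF.trans (bondTriples_mono r₀ (Finset.subset_insert p D))) hT
  have h2 : ∀ y ∈ D, pairEnergy u p y = u ‖p - y‖ := fun y hy =>
    if_neg fun h => hpD (by rwa [h])
  have h3 : ∀ y ∈ D, pairEnergy u y p = u ‖p - y‖ := fun y hy => by
    rw [norm_sub_rev]
    exact if_neg fun h => hpD (by rwa [← h])
  have h4 : ∑ x ∈ insert p D, ∑ y ∈ insert p D, pairEnergy u x y
      = 2 * ∑ y ∈ D, u ‖p - y‖ + ∑ x ∈ D, ∑ y ∈ D, pairEnergy u x y := by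
    rw [Finset.sum_insert hpD, Finset.sum_insert hpD, Finset.sum_congr rfl h2]
    simp_rw [Finset.sum_insert hpD]
    rw [Finset.sum_add_distrib, Finset.sum_congr rfl h3]
    simp [pairEnergy]
    ring
  unfold realEnergy
  rw [h4, hsum, Finset.sum_insert hpD]
  linarith

theorem sum_pair_ge {ε r₀ : ℝ} {u : ℝ → ℝ} (hε : 0 < ε) (hu : IsRealTwoBodyPotential ε r₀ u) (p : ℂ)
    (S K : Finset ℂ) (hK : K ⊆ S) (hclose : ∀ y ∈ K, ‖p - y‖ ≤ 1 - ε) :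
    (K.card : ℝ) * ε⁻¹ - ((S.filter fun y => ‖p - y‖ < r₀).card : ℝ) ≤ ∑ y ∈ S, u ‖p - y‖ := by
  classical
  have hinv : 0 < ε⁻¹ := inv_pos.2 hε
  have h1 : (K.card : ℝ) * ε⁻¹ = ∑ y ∈ S, if y ∈ K then ε⁻¹ else 0 := by
    rw [← Finset.sum_filter, Finset.filter_mem_eq_inter, Finset.inter_eq_right.2 hK]
    simp
  rw [h1, Finset.card_filter]
  push_cast
  rw [← Finset.sum_sub_distrib]
  refine Finset.sum_le_sum fun y _ => ?_
  have hge := hu.neg_one_le (norm_nonneg (p - y))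
  by_cases hyK : y ∈ K
  · have h2 := hu.repulsive _ (norm_nonneg _) (hclose y hyK)
    rw [if_pos hyK]
    split_ifs <;> linarith
  · rw [if_neg hyK]
    split_ifs with h
    · linarith
    · rw [hu.eq_zero _ (not_lt.1 h)]
      simp

/-- The square cell of side length `1 / 2` that contains `y`. -/
noncomputable def halfCell (y : ℂ) : ℤ × ℤ := (⌊2 * y.re⌋, ⌊2 * y.im⌋)

/-- A disc of radius `√2` meets at most `7 × 7` cells. -/
theorem card_le_of_halfCell {S : Finset ℂ} {p : ℂ} {n : ℕ} (hS : ∀ y ∈ S, ‖p - y‖ < √2)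
    (hn : ∀ y ∈ S, (S.filter fun x => halfCell x = halfCell y).card ≤ n) : S.card ≤ 49 * n := by
  classical
  have hs2 : √2 < 3 / 2 := by
    rw [Real.sqrt_lt' (by norm_num)]; norm_num
  have hfl : ∀ a b : ℝ, |a - b| < 3 / 2 → ⌊2 * b⌋ ∈ Finset.Icc (⌊2 * a⌋ - 3) (⌊2 * a⌋ + 3) := by
    intro a b h
    rw [abs_lt] at h
    rw [Finset.mem_Icc]
    constructor
    · rw [Int.le_floor]
      push_cast
      linarith [Int.floor_le (2 * a)]
    · have : ⌊2 * b⌋ < ⌊2 * a⌋ + 4 := by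
        rw [Int.floor_lt]
        push_cast
        linarith [Int.lt_floor_add_one (2 * a)]
      omega
  have hmaps : ∀ y ∈ S, halfCell y ∈ Finset.Icc (⌊2 * p.re⌋ - 3) (⌊2 * p.re⌋ + 3) ×ˢ
      Finset.Icc (⌊2 * p.im⌋ - 3) (⌊2 * p.im⌋ + 3) := by
    intro y hy
    have h1 := (hS y hy).trans hs2
    refine Finset.mem_product.2 ⟨hfl _ _ ?_, hfl _ _ ?_⟩
    · rw [← Complex.sub_re]; exact (Complex.abs_re_le_norm _).trans_lt h1
    · rw [← Complex.sub_im]; exact (Complex.abs_im_le_norm _).trans_lt h1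
  have := Finset.card_le_mul_card_image_of_maps_to hmaps n (fun c _ => by
    rcases (S.filter fun x => halfCell x = c).eq_empty_or_nonempty with h | ⟨y, hy⟩
    · rw [h]; simp
    · obtain ⟨hyS, rfl⟩ := Finset.mem_filter.1 hy
      exact hn y hyS)
  refine this.trans_eq ?_
  rw [Finset.card_product, Int.card_Icc, Int.card_Icc, mul_comm]
  congr 1
  have : ∀ a : ℤ, (a + 3 + 1 - (a - 3)).toNat = 7 := fun a => by omega
  rw [this, this]

theorem norm_sub_le_of_halfCell {ε : ℝ} (hε : ε ≤ 1 / 10) {x y : ℂ} (h : halfCell x = halfCell y) :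
    ‖x - y‖ ≤ 1 - ε := by
  have h1 := (Prod.mk.inj h).1
  have h2 := (Prod.mk.inj h).2
  have key : ∀ a b : ℝ, ⌊2 * a⌋ = ⌊2 * b⌋ → (a - b) ^ 2 ≤ 1 / 4 := by
    intro a b hab
    have h3 := Int.abs_sub_lt_one_of_floor_eq_floor hab
    rw [abs_lt] at h3
    nlinarith
  have h4 : ‖x - y‖ ^ 2 = (x.re - y.re) ^ 2 + (x.im - y.im) ^ 2 := by
    rw [Complex.sq_norm, Complex.normSq_apply]
    simp
    ring
  refine le_of_sq_le_sq ?_ (by linarith)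
  rw [h4]
  have := key _ _ h1
  have := key _ _ h2
  nlinarith

theorem card_substrateNbrs_le {r : ℝ} (hr : r < √2) (p : ℂ) : (substrateNbrs r p).card ≤ 49 := by
  refine (card_le_of_halfCell (p := p) (n := 1) (fun y hy => (mem_substrateNbrs.1 hy).2.trans hr)
    fun y hy => ?_).trans_eq (mul_one _)
  rw [Finset.card_le_one]
  have key : ∀ a : ℤ, ⌊2 * (a : ℝ)⌋ = 2 * a := fun a => by
    rw [show 2 * (a : ℝ) = ((2 * a : ℤ) : ℝ) by push_cast; ring, Int.floor_intCast]
  intro x hx z hz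
  obtain ⟨hx, hx1⟩ := Finset.mem_filter.1 hx
  obtain ⟨hz, hz1⟩ := Finset.mem_filter.1 hz
  obtain ⟨⟨a, b, rfl⟩, -⟩ := (mem_substrateNbrs.1 hx).1
  obtain ⟨⟨c, d, rfl⟩, -⟩ := (mem_substrateNbrs.1 hz).1
  have h := hx1.trans hz1.symm
  simp only [halfCell, key, Prod.mk.injEq] at h
  obtain rfl : a = c := by omega
  obtain rfl : b = d := by omega
  rfl

/-- If two particles are too close, then some particle has positive energy: a particle in the most
crowded cell if some cell contains two particles, and otherwise a particle of the close pair. -/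
theorem exists_pos_of_close {β ε r₀ : ℝ} {u : ℝ → ℝ} (hβ : 0 < β) (hε : 0 < ε) (hε1 : ε ≤ 1 / 10)
    (hε2 : (98 + 49 * β) * ε < min 1 β) (hu : IsRealTwoBodyPotential ε r₀ u) {C : Finset ℂ}
    (hclose : ∃ x ∈ C, (∃ y ∈ C, x ≠ y ∧ ‖x - y‖ ≤ 1 - ε) ∨ ∃ z ∈ substrate, ‖x - z‖ ≤ 1 - ε) :
    ∃ p ∈ C, 0 < ∑ y ∈ C.erase p, u ‖p - y‖ + β * ∑ z ∈ substrateNbrs r₀ p, u ‖p - z‖ := by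
  classical
  obtain ⟨x, hx, hxc⟩ := hclose
  have hinv : 0 < ε⁻¹ := inv_pos.2 hε
  have hinv1 : 98 + 49 * β < ε⁻¹ := by
    rw [lt_inv_comm₀ (by positivity) hε]
    rw [lt_inv_comm₀ hε (by positivity), ← one_div, lt_div_iff₀ hε]
    exact hε2.trans_le (min_le_left _ _)
  have hinv2 : 98 + 49 * β < β * ε⁻¹ := by
    rw [← div_eq_mul_inv, lt_div_iff₀ hε]
    exact hε2.trans_le (min_le_right _ _)
  -- `q` lies in a most crowded cell, and `n` is the number of particles in that cell
  obtain ⟨q, hq, hmax⟩ := C.exists_max_image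
    (fun y => (C.filter fun x => halfCell x = halfCell y).card) ⟨x, hx⟩
  obtain ⟨n, hn⟩ : ∃ n, n = (C.filter fun x => halfCell x = halfCell q).card := ⟨_, rfl⟩
  rw [← hn] at hmax
  have hn1 : 1 ≤ n := by
    rw [hn]
    exact Finset.card_pos.2 ⟨q, Finset.mem_filter.2 ⟨hq, rfl⟩⟩
  have hnear : ∀ p, (((C.erase p).filter fun y => ‖p - y‖ < r₀).card : ℝ) ≤ 49 * n := by
    intro p
    have : ((C.erase p).filter fun y => ‖p - y‖ < r₀).card ≤ 49 * n := by
      refine card_le_of_halfCell (p := p) (fun y hy => (Finset.mem_filter.1 hy).2.trans hu.range_lt)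
        fun y hy => ?_
      have hyC := Finset.mem_of_mem_erase (Finset.mem_filter.1 hy).1
      refine (Finset.card_le_card ?_).trans (hmax y hyC)
      exact Finset.filter_subset_filter _ ((Finset.filter_subset _ _).trans (Finset.erase_subset _ _))
    exact_mod_cast this
  have hsubcard : ∀ p, (((substrateNbrs r₀ p).filter fun y => ‖p - y‖ < r₀).card : ℝ) ≤ 49 := by
    intro p
    have := (Finset.card_filter_le (substrateNbrs r₀ p) fun y => ‖p - y‖ < r₀).trans
      (card_substrateNbrs_le hu.range_lt p)
    exact_mod_cast this
  have hS : ∀ p, ∀ K ⊆ substrateNbrs r₀ p, (∀ y ∈ K, ‖p - y‖ ≤ 1 - ε) →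
      β * (K.card * ε⁻¹ - 49) ≤ β * ∑ z ∈ substrateNbrs r₀ p, u ‖p - z‖ := by
    intro p K hK hKc
    refine mul_le_mul_of_nonneg_left ?_ hβ.le
    have := sum_pair_ge hε hu p _ K hK hKc
    have := hsubcard p
    linarith
  have hS0 : ∀ p, -(49 * β) ≤ β * ∑ z ∈ substrateNbrs r₀ p, u ‖p - z‖ := by
    intro p
    have := hS p ∅ (Finset.empty_subset _) (by simp)
    simp at this
    linarith
  rcases Nat.lt_or_ge n 2 with h2 | h2
  · obtain rfl : n = 1 := by omega
    refine ⟨x, hx, ?_⟩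
    have h0 := hnear x
    rcases hxc with ⟨y, hy, hxy, hd⟩ | ⟨z, hz, hd⟩
    · have h3 := sum_pair_ge hε hu x (C.erase x) {y}
        (Finset.singleton_subset_iff.2 (Finset.mem_erase.2 ⟨hxy.symm, hy⟩)) (by simpa using hd)
      have h4 := hS0 x
      push_cast at h0 h3
      simp only [Finset.card_singleton, Nat.cast_one] at h3
      linarith
    · have h3 := sum_pair_ge hε hu x (C.erase x) ∅ (Finset.empty_subset _) (by simp)
      have h4 := hS x {z} (Finset.singleton_subset_iff.2 (mem_substrateNbrs.2
        ⟨hz, by linarith [hu.one_lt_range]⟩)) (by simpa using hd)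
      simp only [Finset.card_singleton, Finset.card_empty, Nat.cast_one, Nat.cast_zero] at h0 h3 h4
      linarith
  · refine ⟨q, hq, ?_⟩
    have hqm : q ∈ C.filter fun x => halfCell x = halfCell q := Finset.mem_filter.2 ⟨hq, rfl⟩
    have h3 := sum_pair_ge hε hu q (C.erase q) ((C.filter fun x => halfCell x = halfCell q).erase q)
      (Finset.erase_subset_erase _ (Finset.filter_subset _ _)) (fun y hy => by
        have := (Finset.mem_filter.1 (Finset.mem_of_mem_erase hy)).2
        exact norm_sub_le_of_halfCell hε1 this.symm)
    rw [Finset.card_erase_of_mem hqm, ← hn] at h3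
    have h4 := hS0 q
    have h0 := hnear q
    rw [Nat.cast_sub hn1, Nat.cast_one] at h3
    have h5 : (2 : ℝ) ≤ n := by exact_mod_cast h2
    have h6 : ((n : ℝ) - 1) * (98 + 49 * β) < ((n : ℝ) - 1) * ε⁻¹ :=
      mul_lt_mul_of_pos_left hinv1 (by linarith)
    nlinarith

open MeasureTheory in
/-- Packing bound: discs of radius `d / 2` around points with mutual distances at least `d` are
disjoint. -/
theorem card_mul_sq_le {d R : ℝ} (hd : 0 < d) (hR : 0 ≤ R) (p : ℂ) (S : Finset ℂ)
    (hS : ∀ y ∈ S, ‖y - p‖ ≤ R) (hsep : ∀ x ∈ S, ∀ y ∈ S, x ≠ y → d ≤ ‖x - y‖) :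
    (S.card : ℝ) * (d / 2) ^ 2 ≤ (R + d / 2) ^ 2 := by
  have hdisj : (S : Set ℂ).PairwiseDisjoint fun y => Metric.ball y (d / 2) := by
    intro x hx y hy hxy
    refine Metric.ball_disjoint_ball ?_
    rw [dist_eq_norm]
    linarith [hsep x hx y hy hxy]
  have hsub : (⋃ y ∈ S, Metric.ball y (d / 2)) ⊆ Metric.ball p (R + d / 2) := by
    refine Set.iUnion₂_subset fun y hy => Metric.ball_subset_ball' ?_
    rw [dist_eq_norm]
    linarith [hS y hy]
  have h1 := measure_mono (μ := volume) hsub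
  rw [measure_biUnion_finset hdisj fun y _ => Metric.isOpen_ball.measurableSet] at h1
  simp only [Complex.volume_ball, Finset.sum_const, nsmul_eq_mul] at h1
  rw [← mul_assoc, ENNReal.mul_le_mul_iff_left (by simp [NNReal.pi_ne_zero]) (by simp)] at h1
  rw [← ENNReal.ofReal_pow (by linarith), ← ENNReal.ofReal_pow (by linarith),
    ← ENNReal.ofReal_natCast, ← ENNReal.ofReal_mul (by positivity)] at h1
  exact (ENNReal.ofReal_le_ofReal_iff (by positivity)).1 h1

/-! ### Bad bond angles and the number of bonds -/

theorem bondAngle_swap_mem {δ : ℝ} (hδ : δ ≤ 1 / 10) {x y z : ℂ} (hx : x ≠ y) (hz : z ≠ y)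
    (h : bondAngle z y x ∈ nearRightAngles δ) : bondAngle x y z ∈ nearRightAngles δ := by
  have hpi := Real.pi_gt_three
  obtain ⟨n, hn⟩ := exists_bondAngle_eq hx hz
  obtain ⟨m, hm⟩ := exists_bondAngle_eq hz hx
  obtain ⟨h1, h2⟩ := bondAngle_mem_Ico x y z
  have hsum : bondAngle x y z = 2 * Real.pi * (n + m : ℤ) - bondAngle z y x := by
    rw [hn, hm]; push_cast; ring
  obtain ⟨k, hk⟩ : ∃ k, k = n + m := ⟨_, rfl⟩
  rw [← hk] at hsum
  have hb : Real.pi / 2 - δ ≤ bondAngle z y x ∧ bondAngle z y x ≤ 3 * Real.pi / 2 + δ := by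
    rcases h with (⟨h3, h4⟩ | ⟨h3, h4⟩) | ⟨h3, h4⟩ <;> constructor <;> linarith
  have hk1 : k = 1 := by
    have a1 : (0 : ℝ) < k := by
      by_contra hc
      nlinarith [not_lt.1 hc]
    have a2 : (k : ℝ) < 2 := by
      by_contra hc
      nlinarith [not_lt.1 hc]
    have a3 : 0 < k := by exact_mod_cast a1
    have a4 : k < 2 := by exact_mod_cast a2
    omega
  subst hk1
  push_cast at hsum
  rcases h with (⟨h3, h4⟩ | ⟨h3, h4⟩) | ⟨h3, h4⟩
  · exact Or.inr ⟨by linarith, by linarith⟩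
  · exact Or.inl (Or.inr ⟨by linarith, by linarith⟩)
  · exact Or.inl (Or.inl ⟨by linarith, by linarith⟩)

theorem filter_erase_eq_configNbrs (r : ℝ) (C : Finset ℂ) (p : ℂ) :
    (C.erase p).filter (fun y => ‖p - y‖ < r) = configNbrs r C p := by
  ext y
  simp only [Finset.mem_filter, Finset.mem_erase, mem_configNbrs]
  tauto

theorem filter_substrateNbrs (r : ℝ) (p : ℂ) :
    (substrateNbrs r p).filter (fun y => ‖p - y‖ < r) = substrateNbrs r p := by
  rw [Finset.filter_eq_self]
  exact fun y hy => (mem_substrateNbrs.1 hy).2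

theorem one_le_norm_sub_of_lattice {x y : ℂ} (hx : x ∈ squareLattice) (hy : y ∈ squareLattice)
    (hne : x ≠ y) : 1 ≤ ‖x - y‖ := by
  rcases lt_or_ge ‖x - y‖ √2 with h | h
  · rcases lattice_unit hx hy hne h with h | h | h | h <;> rw [h] <;> simp
  · refine le_trans ?_ h
    rw [Real.one_le_sqrt]
    norm_num

/-- In a configuration without close pairs, an atom that takes part in a bond angle away from the
multiples of a right angle has positive energy: by the packing bound the angle costs more than all
bonds of the atom can contribute. -/
theorem exists_erase_lt_of_bad_angle {β ε r₀ : ℝ} {v₂ : ℝ → EReal} {u v₃ : ℝ → ℝ} (hβ : 0 < β)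
    (hε : 0 < ε) (hε1 : ε ≤ 1 / 10) (h₂ : IsTwoBodyPotential ε r₀ v₂)
    (hu : IsRealTwoBodyPotential ε r₀ u) (h₃ : IsThreeBodyPotential β ε v₃) {C : Finset ℂ}
    (hC : ∀ x ∈ C, 0 < x.im) (hsepC : ∀ x ∈ C, ∀ y ∈ C, x ≠ y → 1 - ε < ‖x - y‖)
    (hsepS : ∀ x ∈ C, ∀ z ∈ substrate, 1 - ε < ‖x - z‖) {τ : ℂ × ℂ × ℂ} (hτ : τ ∈ bondTriples r₀ C)
    (hbad : bondAngle τ.1 τ.2.1 τ.2.2 ∉ nearRightAngles ε) :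
    ∃ p ∈ C, realEnergy β r₀ u v₃ (C.erase p) < realEnergy β r₀ u v₃ C := by
  classical
  obtain ⟨x, y, z⟩ := τ
  have hτ' := hτ
  obtain ⟨hx, hy, hz, hxy, hyz, hxz, h1, h2⟩ := hτ'
  dsimp only at hx hy hz hxy hyz hxz h1 h2 hbad
  obtain ⟨p, hp, hpxyz⟩ : ∃ p ∈ C, p = x ∨ p = y ∨ p = z := by
    rcases hx with hx | hx
    · exact ⟨x, hx, Or.inl rfl⟩
    rcases hy with hy | hy
    · exact ⟨y, hy, Or.inr (Or.inl rfl)⟩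
    rcases hz with hz | hz
    · exact ⟨z, hz, Or.inr (Or.inr rfl)⟩
    refine absurd ?_ hbad
    have hlt := hu.range_lt
    rcases bondAngle_lattice hx.1 hy.1 hz.1 hxy hyz hxz (h1.trans hlt) (h2.trans hlt) with h | h | h
    · rw [h]; exact Or.inl (Or.inl ⟨by linarith, by linarith⟩)
    · rw [h]; exact Or.inl (Or.inr ⟨by linarith, by linarith⟩)
    · rw [h]; exact Or.inr ⟨by linarith, by linarith⟩
  have hτ2 : (z, y, x) ∈ bondTriples r₀ C := ⟨hz, hy, hx, hyz.symm, hxy.symm, hxz.symm,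
    by rw [norm_sub_rev]; exact h2, by rw [norm_sub_rev]; exact h1⟩
  have hbad2 : bondAngle z y x ∉ nearRightAngles ε := fun h =>
    hbad (bondAngle_swap_mem hε1 hxy hyz.symm h)
  have hnot : ∀ w, w ∈ ((C.erase p : Finset ℂ) : Set ℂ) ∪ substrate → p ≠ w := by
    rintro w (hw | hw)
    · exact fun h => Finset.notMem_erase p C (by rw [← h] at hw; exact hw)
    · exact ne_of_mem_substrate hC hp hw
  have hne : ((x, y, z) : ℂ × ℂ × ℂ) ≠ (z, y, x) := fun h => hxz (Prod.mk.inj h).1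
  refine ⟨p, hp, ?_⟩
  have hrem := realEnergy_erase_add_le (u := u) h₂ h₃ hp {(x, y, z), (z, y, x)} (by
      intro t ht
      simp only [Finset.coe_insert, Finset.coe_singleton, Set.mem_insert_iff,
        Set.mem_singleton_iff] at ht
      rcases ht with rfl | rfl
      · exact hτ
      · exact hτ2) (by
      intro t ht hmem
      obtain ⟨m1, m2, m3, -⟩ := hmem
      simp only [Finset.mem_insert, Finset.mem_singleton] at ht
      rcases ht with rfl | rfl <;> rcases hpxyz with h | h | h
      · exact hnot _ m1 h
      · exact hnot _ m2 h
      · exact hnot _ m3 h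
      · exact hnot _ m3 h
      · exact hnot _ m2 h
      · exact hnot _ m1 h)
  rw [Finset.sum_pair hne] at hrem
  dsimp only at hrem
  have hv : ∀ {a b c : ℂ}, bondAngle a b c ∉ nearRightAngles ε →
      max 1 (2 * β) * (4 / (1 - ε) ^ 2) * (√2 + 1 / 2) ^ 2 < v₃ (bondAngle a b c) := fun h =>
    h₃.large _ ⟨(bondAngle_mem_Ico _ _ _).1, (bondAngle_mem_Ico _ _ _).2.le⟩ h
  have hv1 := hv hbad
  have hv2 := hv hbad2
  have hd : 0 < 1 - ε := by linarith
  have hdisj : Disjoint (configNbrs r₀ C p) (substrateNbrs r₀ p) := by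
    rw [Finset.disjoint_left]
    intro w hw hw'
    exact ne_of_mem_substrate hC (mem_configNbrs.1 hw).1 (mem_substrateNbrs.1 hw').1 rfl
  have hpack := card_mul_sq_le (d := 1 - ε) (R := √2) hd (Real.sqrt_nonneg 2) p
    (configNbrs r₀ C p ∪ substrateNbrs r₀ p) (by
      intro w hw
      rw [norm_sub_rev]
      have := ((mem_nbrs_iff hC hp).1 hw).2.2
      exact (this.trans hu.range_lt).le) (by
      intro w hw w' hw' hww
      rw [Finset.mem_union, mem_configNbrs, mem_substrateNbrs] at hw hw'
      rcases hw with hw | hw <;> rcases hw' with hw' | hw'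
      · exact (hsepC _ hw.1 _ hw'.1 hww).le
      · exact (hsepS _ hw.1 _ hw'.1).le
      · rw [norm_sub_rev]
        exact (hsepS _ hw'.1 _ hw.1).le
      · exact le_trans (by linarith) (one_le_norm_sub_of_lattice hw.1.1 hw'.1.1 hww))
  rw [Finset.card_union_of_disjoint hdisj] at hpack
  have hcard : ((configNbrs r₀ C p).card : ℝ) + (substrateNbrs r₀ p).card
      ≤ 4 / (1 - ε) ^ 2 * (√2 + 1 / 2) ^ 2 := by
    have h5 : (√2 + (1 - ε) / 2) ^ 2 ≤ (√2 + 1 / 2) ^ 2 :=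
      pow_le_pow_left₀ (by positivity) (by linarith) 2
    rw [div_mul_eq_mul_div, le_div_iff₀ (by positivity)]
    push_cast at hpack
    nlinarith
  have hc := sum_pair_ge hε hu p (C.erase p) ∅ (Finset.empty_subset _) (by simp)
  have hs := sum_pair_ge hε hu p (substrateNbrs r₀ p) ∅ (Finset.empty_subset _) (by simp)
  rw [filter_erase_eq_configNbrs] at hc
  rw [filter_substrateNbrs] at hs
  simp only [Finset.card_empty, Nat.cast_zero, zero_mul, zero_sub] at hc hs
  have hs' := mul_le_mul_of_nonneg_left hs hβ.le
  have hmax1 : 1 ≤ max 1 (2 * β) := le_max_left _ _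
  have hmax2 : β ≤ max 1 (2 * β) := by linarith [le_max_right 1 (2 * β)]
  have n1 : (0 : ℝ) ≤ (configNbrs r₀ C p).card := Nat.cast_nonneg _
  have n2 : (0 : ℝ) ≤ (substrateNbrs r₀ p).card := Nat.cast_nonneg _
  have hfin : ((configNbrs r₀ C p).card : ℝ) + β * (substrateNbrs r₀ p).card
      ≤ max 1 (2 * β) * (4 / (1 - ε) ^ 2) * (√2 + 1 / 2) ^ 2 :=
    calc ((configNbrs r₀ C p).card : ℝ) + β * (substrateNbrs r₀ p).card
        ≤ max 1 (2 * β) * (configNbrs r₀ C p).card + max 1 (2 * β) * (substrateNbrs r₀ p).card := by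
          gcongr
          exact le_mul_of_one_le_left n1 hmax1
      _ = max 1 (2 * β) * (((configNbrs r₀ C p).card : ℝ) + (substrateNbrs r₀ p).card) := by ring
      _ ≤ max 1 (2 * β) * (4 / (1 - ε) ^ 2 * (√2 + 1 / 2) ^ 2) := by gcongr
      _ = _ := by ring
  linarith

/-- Bonds have energy at least `-1`, with equality only for bonds of unit length. -/
theorem neg_bonds_le_realEnergy {β ε r₀ : ℝ} {u v₃ : ℝ → ℝ} (hβ : 0 < β)
    (hu : IsRealTwoBodyPotential ε r₀ u) (C : Finset ℂ) :
    -(1 / 2 * ∑ x ∈ C, ((configNbrs r₀ C x).card : ℝ)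
      + β * ((∑ x ∈ C, (substrateNbrs r₀ x).card : ℕ) : ℝ))
      + 1 / 2 * ∑ᶠ t ∈ bondTriples r₀ C, v₃ (bondAngle t.1 t.2.1 t.2.2) ≤ realEnergy β r₀ u v₃ C ∧
    (realEnergy β r₀ u v₃ C = -(1 / 2 * ∑ x ∈ C, ((configNbrs r₀ C x).card : ℝ)
      + β * ((∑ x ∈ C, (substrateNbrs r₀ x).card : ℕ) : ℝ))
      + 1 / 2 * ∑ᶠ t ∈ bondTriples r₀ C, v₃ (bondAngle t.1 t.2.1 t.2.2) →
      ∀ x ∈ C, (∀ y ∈ configNbrs r₀ C x, ‖x - y‖ = 1) ∧ ∀ z ∈ substrateNbrs r₀ x, ‖x - z‖ = 1) := by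
  classical
  have hone : ∀ w : ℂ, u ‖w‖ + 1 = 0 → ‖w‖ = 1 := by
    intro w hw
    by_contra hne
    linarith [hu.gt_of_ne_one _ (norm_nonneg w) hne]
  have h1 : ∀ x ∈ C, ∀ y ∈ C, 0 ≤ pairEnergy u x y + if y ∈ configNbrs r₀ C x then 1 else 0 := by
    intro x _ y hy
    have hge := hu.neg_one_le (norm_nonneg (x - y))
    by_cases hxy : x = y
    · have : y ∉ configNbrs r₀ C x := fun h => (mem_configNbrs.1 h).2.1 hxy.symm
      rw [pairEnergy, if_pos hxy, if_neg this, add_zero]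
    · rw [pairEnergy, if_neg hxy]
      split_ifs with h
      · linarith
      · rw [hu.eq_zero _ (not_lt.1 fun h' => h (mem_configNbrs.2 ⟨hy, Ne.symm hxy, h'⟩)), add_zero]
  have h2 : ∑ x ∈ C, ∑ y ∈ C, (pairEnergy u x y + if y ∈ configNbrs r₀ C x then 1 else 0)
      = ∑ x ∈ C, ∑ y ∈ C, pairEnergy u x y + ∑ x ∈ C, ((configNbrs r₀ C x).card : ℝ) := by
    rw [← Finset.sum_add_distrib]
    refine Finset.sum_congr rfl fun x _ => ?_
    rw [Finset.sum_add_distrib, ← Finset.sum_filter, Finset.filter_mem_eq_inter,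
      Finset.inter_eq_right.2 fun y hy => (mem_configNbrs.1 hy).1]
    simp
  have h3 : ∀ x ∈ C, ∀ z ∈ substrateNbrs r₀ x, 0 ≤ u ‖x - z‖ + 1 := fun x _ z _ => by
    linarith [hu.neg_one_le (norm_nonneg (x - z))]
  have h4 : ∑ x ∈ C, ∑ z ∈ substrateNbrs r₀ x, (u ‖x - z‖ + 1)
      = ∑ x ∈ C, ∑ z ∈ substrateNbrs r₀ x, u ‖x - z‖
        + ((∑ x ∈ C, (substrateNbrs r₀ x).card : ℕ) : ℝ) := by
    push_cast
    rw [← Finset.sum_add_distrib]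
    refine Finset.sum_congr rfl fun x _ => ?_
    rw [Finset.sum_add_distrib]
    simp
  have h5 := Finset.sum_nonneg fun x hx => Finset.sum_nonneg (h1 x hx)
  have h6 := Finset.sum_nonneg fun x hx => Finset.sum_nonneg (h3 x hx)
  have h6' := mul_nonneg hβ.le h6
  have h4' := congrArg (β * ·) h4
  simp only [mul_add β] at h4'
  unfold realEnergy
  refine ⟨by linarith, fun heq => ?_⟩
  have h7 : ∑ x ∈ C, ∑ y ∈ C, (pairEnergy u x y + if y ∈ configNbrs r₀ C x then 1 else 0) = 0 := by
    linarith
  have h8 : β * ∑ x ∈ C, ∑ z ∈ substrateNbrs r₀ x, (u ‖x - z‖ + 1) = 0 := by linarith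
  have h9 := (mul_eq_zero.1 h8).resolve_left hβ.ne'
  intro x hx
  constructor
  · intro y hy
    have hyC := (mem_configNbrs.1 hy).1
    have e1 := (Finset.sum_eq_zero_iff_of_nonneg fun x hx => Finset.sum_nonneg (h1 x hx)).1 h7 x hx
    have e2 := (Finset.sum_eq_zero_iff_of_nonneg (h1 x hx)).1 e1 y hyC
    rw [if_pos hy, pairEnergy, if_neg (mem_configNbrs.1 hy).2.1.symm] at e2
    exact hone _ e2
  · intro z hz
    have e1 := (Finset.sum_eq_zero_iff_of_nonneg fun x hx => Finset.sum_nonneg (h3 x hx)).1 h9 x hx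
    exact hone _ ((Finset.sum_eq_zero_iff_of_nonneg (h3 x hx)).1 e1 z hz)

/-- The bound on the number of bonds that follows from stratification. -/
theorem bonds_add_le {β r δ : ℝ} (hβ : 0 < β) (hδ : δ ≤ 1 / 10) (hr1 : 1 < r) {C : Finset ℂ}
    (hne : 1 ≤ C.card) (hC : ∀ x ∈ C, 0 < x.im)
    (hgood : ∀ τ ∈ bondTriples r C, bondAngle τ.1 τ.2.1 τ.2.2 ∈ nearRightAngles δ)
    (w : ℝ → ℝ) (hw0 : ∀ θ, 0 ≤ θ → θ ≤ 2 * Real.pi → 0 ≤ w θ)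
    (hw : ∀ θ, |θ - Real.pi| ≤ δ → 10 / Real.pi * |θ - Real.pi| ≤ w θ) :
    1 / 2 * ∑ x ∈ C, ((configNbrs r C x).card : ℝ)
        + β * ((∑ x ∈ C, (substrateNbrs r x).card : ℕ) : ℝ) + 1 / 2 * normalizedMinEnergy β C.card
      ≤ 2 * C.card + ∑ τ ∈ centredTriples r C, w (bondAngle τ.1 τ.2.1 τ.2.2) ∧
    (1 / 2 * ∑ x ∈ C, ((configNbrs r C x).card : ℝ)
        + β * ((∑ x ∈ C, (substrateNbrs r x).card : ℕ) : ℝ) + 1 / 2 * normalizedMinEnergy β C.card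
      = 2 * C.card + ∑ τ ∈ centredTriples r C, w (bondAngle τ.1 τ.2.1 τ.2.2) →
      (C.card : ℝ) / optimalHeight β C.card ≤ ((∑ x ∈ C, (substrateNbrs r x).card : ℕ) : ℝ)) := by
  obtain ⟨a, b, h1, h2, h3, h4⟩ := exists_strata_of_near hδ hr1 hC hgood w hw0 hw
  obtain ⟨h5, h6⟩ := half_normalizedMinEnergy_le hβ hne h1 h2 h3
  exact ⟨by linarith, fun he => h6 (by linarith)⟩

theorem eq_of_bondAngle_mem {y x z : ℂ} (hz : z ≠ x) (hyx : ‖y - x‖ = 1)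
    (hzx : ‖z - x‖ = 1) (hy : y ∈ squareLattice) (hx : x ∈ squareLattice)
    (h : bondAngle y x z ∈ nearRightAngles 0) : z ∈ squareLattice := by
  have hy' : y ≠ x := by
    rintro rfl
    simp at hyx
  obtain ⟨n, hn⟩ := exists_bondAngle_eq hy' hz
  have e1 := Complex.norm_mul_exp_arg_mul_I (y - x)
  have e2 := Complex.norm_mul_exp_arg_mul_I (z - x)
  rw [hyx, Complex.ofReal_one, one_mul] at e1
  rw [hzx, Complex.ofReal_one, one_mul] at e2
  have e3 : y - x = (z - x) * Complex.exp ((bondAngle y x z : ℝ) * Complex.I) := by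
    rw [← e1, ← e2, ← Complex.exp_add, ← add_mul, ← Complex.ofReal_add, hn]
    rw [show (z - x).arg + ((y - x).arg - (z - x).arg + 2 * Real.pi * n)
      = (y - x).arg + n * (2 * Real.pi) by ring]
    push_cast
    rw [add_mul, mul_assoc (n : ℂ), Complex.exp_add, Complex.exp_int_mul_two_pi_mul_I, mul_one]
  obtain ⟨a, b, rfl⟩ := hy
  obtain ⟨c, d, rfl⟩ := hx
  have hcases : ∃ s t : ℤ, z - ⟨c, d⟩ = (⟨a, b⟩ - ⟨c, d⟩) * (⟨(s : ℝ), (t : ℝ)⟩ : ℂ) := by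
    have hI : Complex.exp ((Real.pi / 2 : ℝ) * Complex.I) = Complex.I := by
      push_cast
      exact Complex.exp_pi_div_two_mul_I
    have hm : Complex.exp ((Real.pi : ℝ) * Complex.I) = -1 := Complex.exp_pi_mul_I
    have hI3 : Complex.exp ((3 * Real.pi / 2 : ℝ) * Complex.I) = -Complex.I := by
      rw [show 3 * Real.pi / 2 = Real.pi + Real.pi / 2 by ring, Complex.ofReal_add, add_mul,
        Complex.exp_add, hI, hm, neg_one_mul]
    rcases h with (⟨h1, h2⟩ | ⟨h1, h2⟩) | ⟨h1, h2⟩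
    · rw [show bondAngle _ _ z = Real.pi / 2 by linarith, hI] at e3
      refine ⟨0, -1, ?_⟩
      rw [e3, show (⟨((0 : ℤ) : ℝ), ((-1 : ℤ) : ℝ)⟩ : ℂ) = -Complex.I by
        apply Complex.ext <;> simp, mul_assoc, mul_neg, Complex.I_mul_I, neg_neg, mul_one]
    · rw [show bondAngle _ _ z = Real.pi by linarith, hm] at e3
      refine ⟨-1, 0, ?_⟩
      rw [e3, show (⟨((-1 : ℤ) : ℝ), ((0 : ℤ) : ℝ)⟩ : ℂ) = -1 by
        apply Complex.ext <;> simp]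
      ring
    · rw [show bondAngle _ _ z = 3 * Real.pi / 2 by linarith, hI3] at e3
      refine ⟨0, 1, ?_⟩
      rw [e3, show (⟨((0 : ℤ) : ℝ), ((1 : ℤ) : ℝ)⟩ : ℂ) = Complex.I by
        apply Complex.ext <;> simp, mul_assoc, neg_mul, Complex.I_mul_I, neg_neg, mul_one]
  obtain ⟨s, t, hst⟩ := hcases
  refine ⟨c + ((a - c) * s - (b - d) * t), d + ((a - c) * t + (b - d) * s), ?_⟩
  rw [sub_eq_iff_eq_add'] at hst
  rw [hst]
  apply Complex.ext <;> simp

/-- In a configuration with exact right angles and unit bonds, the points bonded to the substrate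
lie exactly above substrate points. -/
theorem sub_I_of_exact {r : ℝ} (hr1 : 1 < r) {C : Finset ℂ} (hC : ∀ x ∈ C, 0 < x.im)
    (hgood : ∀ τ ∈ bondTriples r C, bondAngle τ.1 τ.2.1 τ.2.2 ∈ nearRightAngles 0)
    (hlen : ∀ x ∈ C, ∀ z ∈ substrateNbrs r x, ‖x - z‖ = 1) {x z : ℂ} (hx : x ∈ C)
    (hz : z ∈ substrateNbrs r x) : x = z + Complex.I := by
  obtain ⟨hz1, hz2⟩ := mem_substrateNbrs.1 hz
  have h1 := arg_sub_substrate (by norm_num) hr1 hC hgood hx hz1 hz2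
  have h2 : (x - z).arg = Real.pi / 2 := by
    have := abs_nonpos_iff.1 h1
    linarith
  have e1 := Complex.norm_mul_exp_arg_mul_I (x - z)
  rw [hlen x hx z hz, h2, Complex.ofReal_one, one_mul, Complex.ofReal_div, Complex.ofReal_ofNat,
    Complex.exp_pi_div_two_mul_I] at e1
  rw [e1]
  ring

/-- A configuration with exact right angles, unit bonds and the maximal number of bonds is contained
in the lattice: the points other than lattice points bonded to a lattice point would form a separate
cluster, and two clusters have fewer bonds than a single one. -/
theorem mem_squareLattice_of_exact {β r : ℝ} (hβ : 0 < β) (hr1 : 1 < r) {C : Finset ℂ}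
    (hC : ∀ x ∈ C, 0 < x.im)
    (hgood : ∀ τ ∈ bondTriples r C, bondAngle τ.1 τ.2.1 τ.2.2 ∈ nearRightAngles 0)
    (hlenC : ∀ x ∈ C, ∀ y ∈ configNbrs r C x, ‖x - y‖ = 1)
    (hlenS : ∀ x ∈ C, ∀ z ∈ substrateNbrs r x, ‖x - z‖ = 1)
    (hcount : 1 / 2 * ∑ x ∈ C, ((configNbrs r C x).card : ℝ)
        + β * ((∑ x ∈ C, (substrateNbrs r x).card : ℕ) : ℝ) + 1 / 2 * normalizedMinEnergy β C.card
      = 2 * C.card) (hs : 0 < ∑ x ∈ C, (substrateNbrs r x).card) :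
    ∀ x ∈ C, x ∈ squareLattice := by
  classical
  -- the lattice points of the configuration that are bonded to another lattice point
  let A : ℂ → Prop := fun x => x ∈ squareLattice ∧
    ∃ w ∈ (C : Set ℂ) ∪ substrate, w ∈ squareLattice ∧ ‖x - w‖ = 1
  have hA : ∀ x ∈ C, A x → ∀ y ∈ configNbrs r C x, A y := by
    rintro x hx ⟨hxL, w, hw, hwL, hxw⟩ y hy
    obtain ⟨hyC, hyx, hxy⟩ := mem_configNbrs.1 hy
    have h1 := hlenC x hx y hy
    refine ⟨?_, x, Or.inl hx, hxL, by rw [norm_sub_rev]; exact h1⟩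
    by_cases hwy : w = y
    · rwa [← hwy]
    · have hwx : w ≠ x := by
        rintro rfl
        simp at hxw
      have hτ : (w, x, y) ∈ bondTriples r C := ⟨hw, Or.inl hx, Or.inl hyC, hwx, hyx.symm, hwy,
        by rw [norm_sub_rev]; linarith, hxy⟩
      have := hgood _ hτ
      dsimp only at this
      exact eq_of_bondAngle_mem hyx (by rw [norm_sub_rev]; exact hxw)
        (by rw [norm_sub_rev]; exact h1) hwL hxL this
  let C₀ := C.filter A
  let C₁ := C.filter fun x => ¬ A x
  have hC₀ : ∀ x ∈ C₀, configNbrs r C₀ x = configNbrs r C x := by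
    intro x hx
    obtain ⟨hxC, hxA⟩ := Finset.mem_filter.1 hx
    ext y
    rw [mem_configNbrs, mem_configNbrs, Finset.mem_filter]
    exact ⟨fun h => ⟨h.1.1, h.2⟩, fun h => ⟨⟨h.1, hA x hxC hxA y (mem_configNbrs.2 h)⟩, h.2⟩⟩
  have hC₁ : ∀ x ∈ C₁, configNbrs r C₁ x = configNbrs r C x := by
    intro x hx
    obtain ⟨hxC, hxA⟩ := Finset.mem_filter.1 hx
    ext y
    rw [mem_configNbrs, mem_configNbrs, Finset.mem_filter]
    refine ⟨fun h => ⟨h.1.1, h.2⟩, fun h => ⟨⟨h.1, fun hyA => hxA ?_⟩, h.2⟩⟩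
    refine hA y h.1 hyA x (mem_configNbrs.2 ⟨hxC, h.2.1.symm, ?_⟩)
    rw [norm_sub_rev]
    exact h.2.2
  have hsplit : ∀ f : ℂ → ℝ, ∑ x ∈ C₀, f x + ∑ x ∈ C₁, f x = ∑ x ∈ C, f x := fun f =>
    Finset.sum_filter_add_sum_filter_not C A f
  have hcard : C₀.card + C₁.card = C.card := Finset.card_filter_add_card_filter_not A
  have hC₀ne : 1 ≤ C₀.card := by
    obtain ⟨x, hx, hx0⟩ := Finset.exists_ne_zero_of_sum_ne_zero hs.ne'
    obtain ⟨z, hz⟩ := Finset.card_pos.1 (Nat.pos_of_ne_zero hx0)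
    have hxz := sub_I_of_exact hr1 hC hgood hlenS hx hz
    have hzs := (mem_substrateNbrs.1 hz).1
    refine Finset.card_pos.2 ⟨x, Finset.mem_filter.2 ⟨hx, ?_, z, Or.inr hzs, hzs.1, hlenS x hx z hz⟩⟩
    obtain ⟨⟨a, b, rfl⟩, -⟩ := hzs
    refine ⟨a, b + 1, ?_⟩
    rw [hxz]
    apply Complex.ext <;> simp
  have hC₁ne : C₁.card = 0 := by
    by_contra hpos
    have hbound : ∀ D ⊆ C, 1 ≤ D.card →
        1 / 2 * ∑ x ∈ D, ((configNbrs r D x).card : ℝ)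
          + β * ((∑ x ∈ D, (substrateNbrs r x).card : ℕ) : ℝ)
          + 1 / 2 * normalizedMinEnergy β D.card ≤ 2 * D.card := by
      intro D hD hD1
      have := (bonds_add_le hβ (by norm_num) hr1 hD1 (fun x hx => hC x (hD hx))
        (fun τ hτ => hgood τ (bondTriples_mono r hD hτ)) (fun _ => 0) (fun _ _ _ => le_rfl)
        (fun θ hθ => by
          rw [le_antisymm hθ (abs_nonneg _)]
          simp)).1
      rw [Finset.sum_const_zero, add_zero] at this
      exact this
    have h0 := hbound C₀ (Finset.filter_subset _ _) hC₀ne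
    have h1 := hbound C₁ (Finset.filter_subset _ _) (Nat.one_le_iff_ne_zero.2 hpos)
    rw [Finset.sum_congr rfl fun x hx => by rw [hC₀ x hx]] at h0
    rw [Finset.sum_congr rfl fun x hx => by rw [hC₁ x hx]] at h1
    have e1 := hsplit fun x => ((configNbrs r C x).card : ℝ)
    have e2 := hsplit fun x => ((substrateNbrs r x).card : ℝ)
    have h2 := normalizedMinEnergy_add_lt (β := β) hC₀ne (Nat.one_le_iff_ne_zero.2 hpos)
    rw [hcard] at h2
    push_cast at h0 h1 hcount
    have e3 : (C₀.card : ℝ) + C₁.card = C.card := by exact_mod_cast hcard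
    have e4 := congrArg (β * ·) e2
    simp only [mul_add β] at e4
    linarith
  intro x hx
  by_contra hxL
  have : x ∈ C₁ := Finset.mem_filter.2 ⟨hx, fun h => hxL h.1⟩
  rw [Finset.card_eq_zero.1 hC₁ne] at this
  exact absurd this (Finset.notMem_empty x)

/-! ### Crystallization -/

/-- The theorem for configurations without close pairs and without bond angles away from the
multiples of a right angle. A quarter of the sum of `v₃` over all triples pays for the broken
strata; as one half of this sum enters the energy, another quarter remains, so that equality forces
exact angles. -/
theorem crystallization_of_good {β ε r₀ : ℝ} {v₂ : ℝ → EReal} {u v₃ : ℝ → ℝ} (hβ : 0 < β)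
    (hε : 0 < ε) (hε1 : ε ≤ 1 / 10) (h₂ : IsTwoBodyPotential ε r₀ v₂)
    (hu : IsRealTwoBodyPotential ε r₀ u) (h₃ : IsThreeBodyPotential β ε v₃) {C : Finset ℂ}
    (hne : 1 ≤ C.card) (hC : ∀ x ∈ C, 0 < x.im)
    (hsepS : ∀ x ∈ C, ∀ z ∈ substrate, 1 - ε < ‖x - z‖)
    (hgood : ∀ τ ∈ bondTriples r₀ C, bondAngle τ.1 τ.2.1 τ.2.2 ∈ nearRightAngles ε) :
    -2 * (C.card : ℝ) + 1 / 2 * normalizedMinEnergy β C.card ≤ realEnergy β r₀ u v₃ C ∧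
    (realEnergy β r₀ u v₃ C = -2 * (C.card : ℝ) + 1 / 2 * normalizedMinEnergy β C.card →
      (∀ x ∈ C, x ∈ squareLattice) ∧
      (C.card : ℝ) / optimalHeight β C.card ≤ (((C : Set ℂ) ∩ {x | x.im = 1}).ncard : ℝ)) := by
  classical
  have hpi := Real.pi_gt_three
  have hr1 := hu.one_lt_range
  obtain ⟨h1, h1'⟩ := neg_bonds_le_realEnergy (v₃ := v₃) hβ hu C
  obtain ⟨h2, h2'⟩ := bonds_add_le hβ hε1 hr1 hne hC hgood (fun θ => 1 / 4 * v₃ θ)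
    (fun θ h0 hpi2 => by
      have := h₃.nonneg h0 hpi2
      positivity)
    (fun θ hθ => by
      have hθ' := abs_le.1 hθ
      have hs := h₃.slope θ ⟨by linarith, by linarith⟩
      have hpos : 0 < Real.pi / 10 - ε := by linarith
      have hinv : 10 / Real.pi ≤ (Real.pi / 10 - ε)⁻¹ := by
        rw [← inv_div]
        exact inv_anti₀ hpos (by linarith)
      have := mul_le_mul_of_nonneg_right hinv (abs_nonneg (θ - Real.pi))
      linarith)
  rw [← Finset.mul_sum] at h2 h2'
  have h3 := sum_le_finsum_bondTriples h₂ h₃ C (centredTriples r₀ C) (centredTriples_subset hC)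
  have h4 := sum_le_finsum_bondTriples h₂ h₃ C ∅ (by simp)
  rw [Finset.sum_empty] at h4
  refine ⟨by linarith, fun heq => ?_⟩
  have hzero : ∑ᶠ t ∈ bondTriples r₀ C, v₃ (bondAngle t.1 t.2.1 t.2.2) = 0 := by linarith
  have h5 : ∑ τ ∈ centredTriples r₀ C, v₃ (bondAngle τ.1 τ.2.1 τ.2.2) = 0 :=
    le_antisymm (hzero ▸ h3) (Finset.sum_nonneg fun t _ =>
      h₃.nonneg (bondAngle_mem_Ico _ _ _).1 (bondAngle_mem_Ico _ _ _).2.le)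
  rw [h5, mul_zero, add_zero] at h2 h2'
  rw [hzero] at h1 h1'
  have hlen := h1' (by linarith)
  have hcount := h2' (by linarith)
  have hexact : ∀ τ ∈ bondTriples r₀ C, bondAngle τ.1 τ.2.1 τ.2.2 ∈ nearRightAngles 0 := by
    intro τ hτ
    have h6 := sum_le_finsum_bondTriples h₂ h₃ C {τ} (by simpa using hτ)
    rw [Finset.sum_singleton, hzero] at h6
    have hI := bondAngle_mem_Ico τ.1 τ.2.1 τ.2.2
    generalize bondAngle τ.1 τ.2.1 τ.2.2 = θ at h6 hI ⊢
    by_contra hno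
    have := h₃.pos θ ⟨hI.1, hI.2.le⟩
      (fun h => hno (Or.inl (Or.inl ⟨by linarith, by linarith⟩)))
      (fun h => hno (Or.inl (Or.inr ⟨by linarith, by linarith⟩)))
      (fun h => hno (Or.inr ⟨by linarith, by linarith⟩))
    linarith
  have hN : (0 : ℝ) < C.card := by exact_mod_cast hne
  have hopt : (0 : ℝ) < optimalHeight β C.card := by
    exact_mod_cast (isGreatest_optimalHeight β hne).1.1.1
  have hspos : (0 : ℝ) < ((∑ x ∈ C, (substrateNbrs r₀ x).card : ℕ) : ℝ) :=
    (div_pos hN hopt).trans_le hcount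
  refine ⟨mem_squareLattice_of_exact hβ hr1 hC hexact (fun x hx => (hlen x hx).1)
    (fun x hx => (hlen x hx).2) (by linarith) (by exact_mod_cast hspos), hcount.trans ?_⟩
  -- every point with a substrate neighbour lies at height `1` and has only one such neighbour
  have hpos := fun x (hx : x ∈ C) z (hz : z ∈ substrateNbrs r₀ x) =>
    sub_I_of_exact hr1 hC hexact (fun x hx => (hlen x hx).2) hx hz
  have hle : ∑ x ∈ C, (substrateNbrs r₀ x).card ≤ (C.filter fun x => x.im = 1).card := by
    rw [Finset.card_filter]
    refine Finset.sum_le_sum fun x hx => ?_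
    split_ifs with him
    · refine Finset.card_le_one.2 fun z hz z' hz' => ?_
      have := (hpos x hx z hz).symm.trans (hpos x hx z' hz')
      exact add_right_cancel this
    · rw [Nat.le_zero, Finset.card_eq_zero, Finset.eq_empty_iff_forall_notMem]
      intro z hz
      obtain ⟨hz1, hz2⟩ := mem_substrateNbrs.1 hz
      have hz0 := im_eq_zero_of_near hu.range_lt (hC x hx)
        (fun z hz => by linarith [hsepS x hx z hz]) hz1 hz2
      apply him
      rw [hpos x hx z hz, Complex.add_im, hz0, Complex.I_im, zero_add]
  have hset : ((C : Set ℂ) ∩ {x | x.im = 1}) = ((C.filter fun x => x.im = 1 : Finset ℂ) : Set ℂ) := by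
    ext x
    simp
  rw [hset, Set.ncard_coe_finset]
  exact_mod_cast hle

/-- The theorem for real-valued two-body potentials, by induction on the number of points: a
configuration that is not good contains a point whose removal decreases the energy strictly. -/
theorem crystallization_real {β ε r₀ : ℝ} {v₂ : ℝ → EReal} {u v₃ : ℝ → ℝ} (hβ : 0 < β)
    (hε : 0 < ε) (hε1 : ε ≤ 1 / 10) (hε2 : (98 + 49 * β) * ε < min 1 β)
    (h₂ : IsTwoBodyPotential ε r₀ v₂) (hu : IsRealTwoBodyPotential ε r₀ u)
    (h₃ : IsThreeBodyPotential β ε v₃) (n : ℕ) :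
    ∀ C : Finset ℂ, C.card = n + 1 → (∀ x ∈ C, 0 < x.im) →
    -2 * (C.card : ℝ) + 1 / 2 * normalizedMinEnergy β C.card ≤ realEnergy β r₀ u v₃ C ∧
    (realEnergy β r₀ u v₃ C = -2 * (C.card : ℝ) + 1 / 2 * normalizedMinEnergy β C.card →
      (∀ x ∈ C, x ∈ squareLattice) ∧
      (C.card : ℝ) / optimalHeight β C.card ≤ (((C : Set ℂ) ∩ {x | x.im = 1}).ncard : ℝ)) := by
  induction n with
  | zero => ?_
  | succ n ih => ?_
  -- both steps reduce to the energy of `C` without one point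
  all_goals
    intro C hcard hC
    by_cases hrem : ∃ p ∈ C, realEnergy β r₀ u v₃ (C.erase p) < realEnergy β r₀ u v₃ C
    rotate_left
    · have hsep : ∀ x ∈ C, (∀ y ∈ C, x ≠ y → 1 - ε < ‖x - y‖) ∧
          ∀ z ∈ substrate, 1 - ε < ‖x - z‖ := by
        by_contra hcon
        push Not at hcon
        obtain ⟨x, hx, hcon⟩ := hcon
        obtain ⟨p, hp, hpos⟩ := exists_pos_of_close hβ hε hε1 hε2 hu (C := C) ⟨x, hx, by
          by_cases h : ∀ y ∈ C, x ≠ y → 1 - ε < ‖x - y‖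
          · exact Or.inr (hcon h)
          · push Not at h
            exact Or.inl h⟩
        have := realEnergy_erase_add_le (u := u) h₂ h₃ hp ∅ (by simp) (by simp)
        rw [Finset.sum_empty] at this
        exact hrem ⟨p, hp, by linarith⟩
      refine crystallization_of_good hβ hε hε1 h₂ hu h₃ (by omega) hC (fun x hx => (hsep x hx).2)
        fun τ hτ => ?_
      by_contra hbad
      exact hrem (exists_erase_lt_of_bad_angle hβ hε hε1 h₂ hu h₃ hC (fun x hx => (hsep x hx).1)
        (fun x hx => (hsep x hx).2) hτ hbad)
    obtain ⟨p, hp, hlt⟩ := hrem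
    have hcard' := Finset.card_erase_of_mem hp
    suffices h : -2 * (C.card : ℝ) + 1 / 2 * normalizedMinEnergy β C.card
        ≤ realEnergy β r₀ u v₃ (C.erase p) from ⟨by linarith, fun he => by linarith⟩
  · have hempty : C.erase p = ∅ := Finset.card_eq_zero.1 (by omega)
    have h4 := sum_le_finsum_bondTriples h₂ h₃ ∅ ∅ (by simp)
    rw [Finset.sum_empty] at h4
    rw [hempty, hcard, zero_add, normalizedMinEnergy_one]
    simp only [realEnergy, Finset.sum_empty, Nat.cast_one]
    linarith
  · have h5 := (ih (C.erase p) (by omega) fun x hx => hC x (Finset.mem_of_mem_erase hx)).1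
    have hn : C.card = (n + 1) + 1 := hcard
    rw [show (C.erase p).card = n + 1 by omega] at h5
    have h6 := normalizedMinEnergy_succ_le hβ (N := n + 1) (by omega)
    rw [hn]
    push_cast at h5 ⊢
    linarith

end SubstrateCrystal

theorem theorem2p1 (β : ℝ) (hβ : 0 < β) :
    ∃ ε₀ : ℝ, 0 < ε₀ ∧ ε₀ < Real.pi / 6 ∧ ∃ Nβ : ℕ,
      ∀ (ε : ℝ), 0 < ε → ε < ε₀ →
      ∀ (r₀ : ℝ) (v₂ : ℝ → EReal) (v₃ : ℝ → ℝ),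
        SubstrateCrystal.IsTwoBodyPotential ε r₀ v₂ →
        SubstrateCrystal.IsThreeBodyPotential β ε v₃ →
      ∀ (N : ℕ) (C : Finset ℂ), Nβ ≤ N → C.card = N → (∀ x ∈ C, 0 < x.im) →
        ((-2 * (N : ℝ) + 1 / 2 * SubstrateCrystal.normalizedMinEnergy β N : ℝ) : EReal)
            ≤ SubstrateCrystal.energy β r₀ v₂ v₃ C ∧
        (SubstrateCrystal.energy β r₀ v₂ v₃ C
            = ((-2 * (N : ℝ) + 1 / 2 * SubstrateCrystal.normalizedMinEnergy β N : ℝ) : EReal) →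
          (∀ x ∈ C, x ∈ SubstrateCrystal.squareLattice ∧ 0 < x.im) ∧
          (N : ℝ) / (SubstrateCrystal.optimalHeight β N : ℝ)
            ≤ (((C : Set ℂ) ∩ {x | x.im = 1}).ncard : ℝ)) := by
  have hmin : 0 < min 1 β := lt_min one_pos hβ
  have hpi := Real.pi_gt_three
  -- a repulsion of more than `98 + 49 β`, with weight `1` or `β`, outweighs all bonds of a point in a
  -- crowded cell
  refine ⟨min (1 / 10) (min 1 β / (98 + 49 * β)), lt_min (by norm_num) (by positivity),
    (min_le_left _ _).trans_lt (by linarith), 1, ?_⟩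
  intro ε hε hεlt r₀ v₂ v₃ h₂ h₃ N C hN hcard hC
  have hε1 : ε ≤ 1 / 10 := (hεlt.trans_le (min_le_left _ _)).le
  have hε2 : (98 + 49 * β) * ε < min 1 β := by
    have := hεlt.trans_le (min_le_right _ _)
    rwa [lt_div_iff₀' (by positivity)] at this
  obtain ⟨u, hu, huv⟩ := SubstrateCrystal.exists_truncation hε h₂
  have hle := SubstrateCrystal.realEnergy_le_energy (v₃ := v₃) hβ h₂ huv C
  obtain ⟨h1, h2⟩ := SubstrateCrystal.crystallization_real hβ hε hε1 hε2 h₂ hu h₃ (N - 1) C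
    (by omega) hC
  rw [hcard] at h1 h2
  refine ⟨(EReal.coe_le_coe_iff.2 h1).trans hle, fun heq => ?_⟩
  rw [heq, EReal.coe_le_coe_iff] at hle
  obtain ⟨h3, h4⟩ := h2 (le_antisymm hle h1)
  exact ⟨fun x hx => ⟨h3 x hx, hC x hx⟩, h4⟩
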